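/- Let $\mathbf{k}$ be a field of characteristic $0$; all vector spaces are over $\mathbf{k}$, $\sigma$ is the flip. Definitions. A perm algebra is a space $P$ with a bilinear product such that $p(qr)=(pq)r=(qp)r$. A perm coalgebra is a space $P$ with a linear map $\Delta_P:P\to P\otimes P$ such that $(\Delta_P\otimes\mathrm{id})\Delta_P=(\mathrm{id}\otimes\Delta_P)\Delta_P=(\sigma\otimes\mathrm{id})(\Delta_P\otimes\mathrm{id})\Delta_P$. With $L(p)q=pq$ and $R(p)q=qp$, a perm bialgebra is a triple $(P,\cdot,\Delta_P)$ that is both and satisfies, for all $p,q\in P$, $$\Delta_P(pq)=((L-R)(p)\otimes\mathrm{id})\Delta_P(q)+(\mathrm{id}\otimes R(q))\Delta_P(p),\qquad \sigma(R(q)\otimes\mathrm{id})\Delta_P(p)=(R(p)\otimes\mathrm{id})\Delta_P(q),$$ $$\Delta_P(pq)=(\mathrm{id}\otimes L(p))\Delta_P(q)+((L-R)(q)\otimes\mathrm{id})(\Delta_P(p)-\sigma\Delta_P(p)).$$ A quadratic $\mathbb{Z}$-graded pre-Lie algebra $(A,\diamond,\omega)$ is a graded space $A=\bigoplus_{i\in\mathbb{Z}}A_i$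 with all $A_i$ finite-dimensional, a bilinear product with $A_i\diamond A_j\subseteq A_{i+j}$ and $(a\diamond b)\diamond c-a\diamond(b\diamond c)=(b\diamond a)\diamond c-b\diamond(a\diamond c)$, and a nondegenerate skew-symmetric bilinear form $\omega$ such that $\omega(a\diamond b,c)=-\omega(b,a\diamond c-c\diamond a)$ and, for some $m\in\mathbb{Z}$, $\omega(A_i,A_j)=0$ whenever $i+j\neq m$. For graded spaces put $C\hat\otimes D=\prod_{i,j}C_i\otimes D_j$, whose elements are written as formal infinite sums of tensors; $\hat\sigma$, and $f\hat\otimes g$ for maps for which the termwise formula involves only finite sums in each entry, are defined termwise. A completed Lie coalgebra is a graded space $L=\bigoplus_i L_i$ with a linear map $\delta:L\to L\hat\otimes L$ for which $\delta\hat\otimes\mathrm{id}$ and $\mathrm{id}\hat\otimes\delta$ are defined (each entry of $\delta$ vanishes on all but finitely many $L_i$), $\delta+\hat\sigma\delta=0$ and $(\mathrm{id}\hat\otimes\delta)\delta-(\hat\sigma\hat\otimes\mathrm{id})(\mathrm{id}\hat\otimes\delta)\delta-(\delta\hat\otimes\mathrm{id})\delta=0$. A completed Lie bialgebra is such a pair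 together with a Lie bracket on $L$ for which the maps $\mathrm{ad}(a)\hat\otimes\mathrm{id}$, $\mathrm{id}\hat\otimes\mathrm{ad}(a)$ are likewise defined (each homogeneous component of $\mathrm{ad}(a)$ vanishes on all but finitely many $L_i$) and $$\delta([a,b])=(\mathrm{ad}(a)\hat\otimes\mathrm{id}+\mathrm{id}\hat\otimes\mathrm{ad}(a))\delta(b)-(\mathrm{ad}(b)\hat\otimes\mathrm{id}+\mathrm{id}\hat\otimes\mathrm{ad}(b))\delta(a).$$ Given a bilinear product and a linear map $\Delta_P:P\to P\otimes P$ on a space $P$, a quadratic $\mathbb{Z}$-graded pre-Lie algebra $A$ and a linear map $\Delta_A:A\to A\hat\otimes A$, grade $L=P\otimes A$ by $L_i=P\otimes A_i$ and put $$[p\otimes a,q\otimes b]=pq\otimes a\diamond b-qp\otimes b\diamond a,\qquad \delta(p\otimes a)=(\mathrm{id}-\hat\sigma)(\Delta_P(p)\bullet\Delta_A(a)),$$ where $(p\otimes q)\bullet\sum a\otimes b=\sum(p\otimes a)\otimes(q\otimes b)$. Theorem. (1) Let $(P,\cdot,\Delta_P)$ be a perm bialgebra and $(A,\diamond,\omega)$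 a quadratic $\mathbb{Z}$-graded pre-Lie algebra. There is exactly one linear map $\Delta_A:A\to A\hat\otimes A$ with $\widetilde\omega(\Delta_A(a),b\otimes c)=-\omega(a,b\diamond c)$ for all $a,b,c\in A$, where $\widetilde\omega(\sum u\otimes v,b\otimes c)=\sum\omega(u,b)\omega(v,c)$. With this $\Delta_A$, $(L,[-,-],\delta)$ is a completed Lie bialgebra. If $P$ is finite-dimensional, then so are all $L_i$. (2) Let $A=\mathbf{k}[t,t^{-1}]\oplus\mathbf{k}[s,s^{-1}]$ with $A_i=\mathbf{k}t^{i+1}\oplus\mathbf{k}s^{i+1}$, $$t^i\diamond t^j=jt^{i+j-1},\quad t^i\diamond s^j=(2i+j-1)s^{i+j-1},\quad s^j\diamond t^i=is^{i+j-1},\quad s^i\diamond s^j=0,$$ and $\omega(s^i,t^j)=-\omega(t^j,s^i)=\delta_{i+j,0}$, $\omega(t^i,t^j)=\omega(s^i,s^j)=0$. This is a quadratic $\mathbb{Z}$-graded pre-Lie algebra. Let $P$ be any vector space with a bilinear product $\cdot$ and a linear map $\Delta_P:P\to P\otimes P$, and let $\Delta_A$ be the unique map determined by $\omega$ as in (1).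 Then $(L,[-,-],\delta)$ is a completed Lie bialgebra if and only if $(P,\cdot,\Delta_P)$ is a perm bialgebra. Moreover, all $L_i$ are finite-dimensional if and only if $P$ is. -/

import Mathlib

open scoped TensorProduct LaurentPolynomial

noncomputable section

namespace PermAffinization

/-! ### Completed tensor products of `ℤ`-graded vector spaces -/

section Completed

variable {k : Type*} [Field k]
variable {C D M N : Type*} [AddCommGroup C] [Module k C] [AddCommGroup D] [Module k D]
  [AddCommGroup M] [Module k M] [AddCommGroup N] [Module k N]

/-- The completed tensor product `C ⊗̂ D = ∏_{i,j} C_i ⊗ D_j` of graded vector spaces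
`C = ⨁ C_i` and `D = ⨁ D_j`. As `k` is a field, `C_i ⊗ D_j` is a subspace of `C ⊗ D`, and an
element of the product is a family `x` in `C ⊗ D` whose `(i, j)` entry lies in `C_i ⊗ D_j`. It
stands for the formal infinite sum of its entries. -/
def completedTensor (𝒞 : ℤ → Submodule k C) (𝒟 : ℤ → Submodule k D) :
    Submodule k (ℤ × ℤ → C ⊗[k] D) :=
  Submodule.pi Set.univ fun ij =>
    LinearMap.range (TensorProduct.map (𝒞 ij.1).subtype (𝒟 ij.2).subtype)

/-- The completed flip `σ̂`, sending the formal sum of the `c ⊗ d` to that of the `d ⊗ c`. -/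
def completedFlip (𝒞 : ℤ → Submodule k C) :
    completedTensor 𝒞 𝒞 →ₗ[k] completedTensor 𝒞 𝒞 :=
  LinearMap.restrict
    (LinearMap.pi fun ij : ℤ × ℤ =>
      (TensorProduct.comm k C C).toLinearMap ∘ₗ
        (LinearMap.proj ij.swap : (ℤ × ℤ → C ⊗[k] C) →ₗ[k] C ⊗[k] C))
    (by
      intro x hx ij _
      obtain ⟨y, hy⟩ := hx ij.swap (Set.mem_univ _)
      refine ⟨TensorProduct.comm k _ _ y, ?_⟩
      simp only [LinearMap.pi_apply, LinearMap.comp_apply, LinearMap.proj_apply, ← hy]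
      exact TensorProduct.map_comm _ _ y)

/-- The map `id - σ̂`. -/
def idSubFlip (𝒞 : ℤ → Submodule k C) :
    completedTensor 𝒞 𝒞 →ₗ[k] completedTensor 𝒞 𝒞 :=
  LinearMap.id - completedFlip 𝒞

/-- The embedding of `C = ⨁ C_i` into `∏ C_i`: the family of homogeneous components. -/
def components (𝒞 : ℤ → Submodule k C) [DirectSum.Decomposition 𝒞] : C →ₗ[k] (ℤ → C) :=
  LinearMap.pi fun i =>
    (𝒞 i).subtype ∘ₗ DirectSum.component k ℤ (fun i => 𝒞 i) i ∘ₗ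
      (DirectSum.decomposeLinearEquiv 𝒞).toLinearMap

/-- A linear map from `C = ⨁ C_i` to a product is column-finite if each of its coordinates
vanishes on all but finitely many of the `C_i`, that is, if it may be applied termwise to formal
infinite sums of homogeneous elements. -/
def IsColumnFinite {ι : Type*} (𝒞 : ℤ → Submodule k C) (f : C →ₗ[k] (ι → M)) : Prop :=
  ∀ s : ι, {i : ℤ | ∃ c ∈ 𝒞 i, f c s ≠ 0}.Finite

/-- The map `f ⊗̂ g`: the formal sum of the `c ⊗ d` is sent to the formal sum of the
`f c ⊗ g d`, collected in each entry of the target. All these sums are finite when `f` and `g` are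
column-finite. -/
def completedMap {ι κ : Type*} (f : C →ₗ[k] (ι → M)) (g : D →ₗ[k] (κ → N))
    (x : ℤ × ℤ → C ⊗[k] D) : ι × κ → M ⊗[k] N :=
  fun s => ∑ᶠ ij : ℤ × ℤ,
    TensorProduct.map (LinearMap.proj s.1 ∘ₗ f) (LinearMap.proj s.2 ∘ₗ g) (x ij)

/-- The identification of `(C ⊗̂ C) ⊗̂ C` with `C ⊗̂ (C ⊗̂ C)`. -/
def reassoc (x : (ℤ × ℤ) × ℤ → (C ⊗[k] C) ⊗[k] C) : ℤ × ℤ × ℤ → C ⊗[k] (C ⊗[k] C) :=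
  fun s => TensorProduct.assoc k C C C (x ((s.1, s.2.1), s.2.2))

/-- The map `σ̂ ⊗̂ id` on threefold completed tensors. -/
def flipFirstTwo (x : ℤ × ℤ × ℤ → C ⊗[k] (C ⊗[k] C)) : ℤ × ℤ × ℤ → C ⊗[k] (C ⊗[k] C) :=
  fun s => TensorProduct.leftComm k C C C (x (s.2.1, s.1, s.2.2))

end Completed

/-! ### Perm algebras, perm coalgebras, perm bialgebras -/

section Perm

variable {k : Type*} [Field k] {P : Type*} [AddCommGroup P] [Module k P]

/-- `(P, ·)` is a perm algebra: `p(qr) = (pq)r = (qp)r`. -/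
structure IsPermAlgebra (mul : P →ₗ[k] P →ₗ[k] P) : Prop where
  assoc : ∀ p q r : P, mul p (mul q r) = mul (mul p q) r
  left_comm : ∀ p q r : P, mul (mul p q) r = mul (mul q p) r

/-- `(P, Δ)` is a perm coalgebra: `(Δ ⊗ id)Δ = (id ⊗ Δ)Δ = (σ ⊗ id)(Δ ⊗ id)Δ`. -/
structure IsPermCoalgebra (Δ : P →ₗ[k] P ⊗[k] P) : Prop where
  coassoc : ∀ p : P, TensorProduct.assoc k P P P (Δ.rTensor P (Δ p)) = Δ.lTensor P (Δ p)
  left_cocomm : ∀ p : P, Δ.rTensor P (Δ p) =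
    (TensorProduct.comm k P P).toLinearMap.rTensor P (Δ.rTensor P (Δ p))

/-- `(P, ·, Δ)` is a perm bialgebra. Here `mul p` is left and `mul.flip p` is right multiplication
by `p`. -/
structure IsPermBialgebra (mul : P →ₗ[k] P →ₗ[k] P) (Δ : P →ₗ[k] P ⊗[k] P) : Prop where
  algebra : IsPermAlgebra mul
  coalgebra : IsPermCoalgebra Δ
  compat₁ : ∀ p q : P, Δ (mul p q) =
    (mul p - mul.flip p).rTensor P (Δ q) + (mul.flip q).lTensor P (Δ p)
  compat₂ : ∀ p q : P, TensorProduct.comm k P P ((mul.flip q).rTensor P (Δ p)) =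
    (mul.flip p).rTensor P (Δ q)
  compat₃ : ∀ p q : P, Δ (mul p q) =
    (mul p).lTensor P (Δ q) +
      (mul q - mul.flip q).rTensor P (Δ p - TensorProduct.comm k P P (Δ p))

end Perm

/-! ### Quadratic `ℤ`-graded pre-Lie algebras -/

section PreLie

variable {k : Type*} [Field k] {A : Type*} [AddCommGroup A] [Module k A]

/-- `(A = ⨁ A_i, ⋄)` is a `ℤ`-graded (left) pre-Lie algebra with finite-dimensional `A_i`. -/
structure IsGradedPreLie (𝒜 : ℤ → Submodule k A) [DirectSum.Decomposition 𝒜]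
    (dia : A →ₗ[k] A →ₗ[k] A) : Prop where
  preLie : ∀ a b c : A,
    dia (dia a b) c - dia a (dia b c) = dia (dia b a) c - dia b (dia a c)
  finiteDimensional : ∀ i : ℤ, FiniteDimensional k (𝒜 i)
  mem : ∀ (i j : ℤ) (a b : A), a ∈ 𝒜 i → b ∈ 𝒜 j → dia a b ∈ 𝒜 (i + j)

/-- `(A = ⨁ A_i, ⋄, ω)` is a quadratic `ℤ`-graded pre-Lie algebra: `ω` is a skew-symmetric,
nondegenerate, invariant and graded bilinear form. -/
structure IsQuadraticGradedPreLie (𝒜 : ℤ → Submodule k A) [DirectSum.Decomposition 𝒜]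
    (dia : A →ₗ[k] A →ₗ[k] A) (ω : LinearMap.BilinForm k A) : Prop extends
    IsGradedPreLie 𝒜 dia where
  skew : ∀ a b : A, ω a b = -ω b a
  nondegenerate : ω.Nondegenerate
  invariant : ∀ a b c : A, ω (dia a b) c = -ω b (dia a c - dia c a)
  graded : ∃ m : ℤ, ∀ i j : ℤ, i + j ≠ m → ∀ a ∈ 𝒜 i, ∀ b ∈ 𝒜 j, ω a b = 0

/-- The pairing `ω̃(x, b ⊗ c)` of `x ∈ A ⊗̂ A` with `b ⊗ c`: the sum of the `ω(u, b) ω(v, c)` over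
the terms `u ⊗ v` of `x`. Only finitely many entries of `x` contribute when `ω` is graded. -/
def completedPairing (ω : LinearMap.BilinForm k A) (x : ℤ × ℤ → A ⊗[k] A) (b c : A) : k :=
  ∑ᶠ ij : ℤ × ℤ, LinearMap.mul' k k (TensorProduct.map (ω.flip b) (ω.flip c) (x ij))

/-- `Δ : A → A ⊗̂ A` is the coproduct induced by `ω`:
`ω̃(Δ a, b ⊗ c) = -ω(a, b ⋄ c)`. -/
def IsInducedCoproduct (𝒜 : ℤ → Submodule k A) (dia : A →ₗ[k] A →ₗ[k] A)
    (ω : LinearMap.BilinForm k A) (Δ : A →ₗ[k] completedTensor 𝒜 𝒜) : Prop :=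
  ∀ a b c : A, completedPairing ω (Δ a : ℤ × ℤ → A ⊗[k] A) b c = -ω a (dia b c)

end PreLie

/-! ### Completed Lie bialgebras -/

section Lie

variable {k : Type*} [Field k] {L : Type*} [AddCommGroup L] [Module k L]

/-- `(L, [-,-])` is a Lie algebra. -/
structure IsLieBracket (br : L →ₗ[k] L →ₗ[k] L) : Prop where
  self : ∀ a : L, br a a = 0
  jacobi : ∀ a b c : L, br a (br b c) + br b (br c a) + br c (br a b) = 0

/-- `(L = ⨁ L_i, δ)` is a completed Lie coalgebra. Column-finiteness is what makes the iterated
maps `(δ ⊗̂ id)δ` and `(id ⊗̂ δ)δ` meaningful. Finite-dimensionality of the `L_i` is not needed for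
any of this and is stated separately where it is claimed. -/
structure IsCompletedLieCoalgebra (ℒ : ℤ → Submodule k L) [DirectSum.Decomposition ℒ]
    (δ : L →ₗ[k] completedTensor ℒ ℒ) : Prop where
  columnFinite : IsColumnFinite ℒ ((completedTensor ℒ ℒ).subtype ∘ₗ δ)
  skew : ∀ a : L, δ a + completedFlip ℒ (δ a) = 0
  coJacobi : ∀ a : L,
    completedMap (components ℒ) ((completedTensor ℒ ℒ).subtype ∘ₗ δ) (δ a).1
      - flipFirstTwo
          (completedMap (components ℒ) ((completedTensor ℒ ℒ).subtype ∘ₗ δ) (δ a).1)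
      - reassoc (completedMap ((completedTensor ℒ ℒ).subtype ∘ₗ δ) (components ℒ) (δ a).1) = 0

/-- The operator `ad(a) ⊗̂ id + id ⊗̂ ad(a)`. -/
def adAction (ℒ : ℤ → Submodule k L) [DirectSum.Decomposition ℒ] (br : L →ₗ[k] L →ₗ[k] L)
    (a : L) (x : ℤ × ℤ → L ⊗[k] L) : ℤ × ℤ → L ⊗[k] L :=
  completedMap (components ℒ ∘ₗ br a) (components ℒ) x
    + completedMap (components ℒ) (components ℒ ∘ₗ br a) x

/-- `(L = ⨁ L_i, [-,-], δ)` is a completed Lie bialgebra. Column-finiteness of the `ad(a)` is what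
makes `ad(a) ⊗̂ id` and `id ⊗̂ ad(a)` meaningful. -/
structure IsCompletedLieBialgebra (ℒ : ℤ → Submodule k L) [DirectSum.Decomposition ℒ]
    (br : L →ₗ[k] L →ₗ[k] L) (δ : L →ₗ[k] completedTensor ℒ ℒ) : Prop where
  lie : IsLieBracket br
  coalgebra : IsCompletedLieCoalgebra ℒ δ
  ad_columnFinite : ∀ a : L, IsColumnFinite ℒ (components ℒ ∘ₗ br a)
  compat : ∀ a b : L,
    (δ (br a b)).1 = adAction ℒ br a (δ b).1 - adAction ℒ br b (δ a).1

end Lie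

/-! ### The bracket and the cobracket on `P ⊗ A` -/

section Affinization

variable {k : Type*} [Field k] (P : Type*) [AddCommGroup P] [Module k P]
  {A : Type*} [AddCommGroup A] [Module k A]

/-- The grading `(P ⊗ A)_i = P ⊗ A_i` of `P ⊗ A`. -/
def tensorGrading (𝒜 : ℤ → Submodule k A) : ℤ → Submodule k (P ⊗[k] A) :=
  fun i => LinearMap.range ((𝒜 i).subtype.lTensor P)

/-- The canonical map from `P ⊗ A_i` onto the subspace `(P ⊗ A)_i` of `P ⊗ A`. -/
def tensorGradingMap (𝒜 : ℤ → Submodule k A) (i : ℤ) :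
    P ⊗[k] 𝒜 i →ₗ[k] tensorGrading P 𝒜 i :=
  ((𝒜 i).subtype.lTensor P).rangeRestrict

theorem tensorGradingMap_tmul (𝒜 : ℤ → Submodule k A) (i : ℤ) (p : P) (a : 𝒜 i) :
    (tensorGradingMap P 𝒜 i (p ⊗ₜ[k] a) : P ⊗[k] A) = p ⊗ₜ[k] (a : A) := rfl

theorem tensorGradingMap_surjective (𝒜 : ℤ → Submodule k A) (i : ℤ) :
    Function.Surjective (tensorGradingMap P 𝒜 i) :=
  ((𝒜 i).subtype.lTensor P).surjective_rangeRestrict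

instance tensorGradingDecomposition (𝒜 : ℤ → Submodule k A) [DirectSum.Decomposition 𝒜] :
    DirectSum.Decomposition (tensorGrading P 𝒜) :=
  DirectSum.Decomposition.ofLinearMap (tensorGrading P 𝒜)
    (DirectSum.toModule k ℤ _ (fun i =>
        DirectSum.lof k ℤ (fun i => tensorGrading P 𝒜 i) i ∘ₗ tensorGradingMap P 𝒜 i) ∘ₗ
      (TensorProduct.directSumRight k k P (fun i => 𝒜 i)).toLinearMap ∘ₗ
        (DirectSum.decomposeLinearEquiv 𝒜).toLinearMap.lTensor P)
    (by
      ext p a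
      induction a using DirectSum.Decomposition.inductionOn 𝒜 with
      | zero => simp
      | homogeneous a => simp [tensorGradingMap_tmul]
      | add a b ha hb => simpa [TensorProduct.tmul_add] using congrArg₂ (· + ·) ha hb)
    (by
      refine DirectSum.linearMap_ext k fun i => ?_
      rw [← LinearMap.cancel_right (tensorGradingMap_surjective P 𝒜 i)]
      ext p a
      simp [tensorGradingMap_tmul])

variable {P}

/-- The induced bracket `[p ⊗ a, q ⊗ b] = pq ⊗ a ⋄ b - qp ⊗ b ⋄ a` on `P ⊗ A`. -/
def inducedBracket (mul : P →ₗ[k] P →ₗ[k] P) (dia : A →ₗ[k] A →ₗ[k] A) :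
    P ⊗[k] A →ₗ[k] P ⊗[k] A →ₗ[k] P ⊗[k] A :=
  TensorProduct.map₂ mul dia - (TensorProduct.map₂ mul dia).flip

/-- The operation `•` that combines an element of `P ⊗ P` with one of `A ⊗̂ A`, given by
`(p ⊗ q) • ∑ a ⊗ b = ∑ (p ⊗ a) ⊗ (q ⊗ b)`. -/
def bullet (𝒜 : ℤ → Submodule k A) :
    P ⊗[k] P →ₗ[k] completedTensor 𝒜 𝒜 →ₗ[k]
      completedTensor (tensorGrading P 𝒜) (tensorGrading P 𝒜) :=
  LinearMap.mk₂ k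
    (fun u x => ⟨fun ij => TensorProduct.tensorTensorTensorComm k P P A A (u ⊗ₜ[k] x.1 ij), by
      intro ij _
      obtain ⟨y, hy⟩ := x.2 ij (Set.mem_univ _)
      change TensorProduct.tensorTensorTensorComm k P P A A (u ⊗ₜ[k] x.1 ij) ∈ LinearMap.range _
      rw [← hy]
      induction u with
      | zero => simp
      | add u v hu hv => rw [TensorProduct.add_tmul, map_add]; exact add_mem hu hv
      | tmul p q =>
        clear hy
        induction y with
        | zero => simp
        | add y z hy hz => rw [map_add, TensorProduct.tmul_add, map_add]; exact add_mem hy hz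
        | tmul a b =>
          exact ⟨⟨p ⊗ₜ a.1, p ⊗ₜ a, by simp⟩ ⊗ₜ ⟨q ⊗ₜ b.1, q ⊗ₜ b, by simp⟩, by simp⟩⟩)
    (by intros; ext ij; simp [TensorProduct.add_tmul])
    (by intros; ext ij; simp [← TensorProduct.smul_tmul'])
    (by intros; ext ij; simp [TensorProduct.tmul_add])
    (by intros; ext ij; simp)

/-- The induced cobracket `δ(p ⊗ a) = (id - σ̂)(Δ_P(p) • Δ_A(a))` on `P ⊗ A`. -/
def inducedCobracket {𝒜 : ℤ → Submodule k A} (ΔP : P →ₗ[k] P ⊗[k] P)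
    (ΔA : A →ₗ[k] completedTensor 𝒜 𝒜) :
    P ⊗[k] A →ₗ[k] completedTensor (tensorGrading P 𝒜) (tensorGrading P 𝒜) :=
  idSubFlip (tensorGrading P 𝒜) ∘ₗ TensorProduct.lift (bullet 𝒜) ∘ₗ TensorProduct.map ΔP ΔA

end Affinization

/-! ### The quadratic graded pre-Lie algebra `k[t, t⁻¹] ⊕ k[s, s⁻¹]` -/

section Laurent

variable (k : Type*) [Field k]

/-- The vector space `k[t, t⁻¹] ⊕ k[s, s⁻¹]`. -/
abbrev LaurentPair : Type _ := k[T;T⁻¹] × k[T;T⁻¹]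

/-- The basis of all `t^i` (index `Sum.inl i`) and all `s^i` (index `Sum.inr i`). -/
def laurentBasis : Module.Basis (ℤ ⊕ ℤ) k (LaurentPair k) :=
  (AddMonoidAlgebra.basis ℤ k).prod (AddMonoidAlgebra.basis ℤ k)

/-- The element `t^i`. -/
def tPow (i : ℤ) : LaurentPair k := laurentBasis k (Sum.inl i)

/-- The element `s^i`. -/
def sPow (i : ℤ) : LaurentPair k := laurentBasis k (Sum.inr i)

/-- The operation with `t^i ⋄ t^j = j t^(i+j-1)`, `t^i ⋄ s^j = (2i+j-1) s^(i+j-1)`,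
`s^j ⋄ t^i = i s^(i+j-1)` and `s^i ⋄ s^j = 0`. -/
def laurentDia : LaurentPair k →ₗ[k] LaurentPair k →ₗ[k] LaurentPair k :=
  (laurentBasis k).constr k fun x => (laurentBasis k).constr k fun y =>
    match x, y with
    | Sum.inl i, Sum.inl j => (j : k) • tPow k (i + j - 1)
    | Sum.inl i, Sum.inr j => (2 * i + j - 1 : k) • sPow k (i + j - 1)
    | Sum.inr j, Sum.inl i => (i : k) • sPow k (i + j - 1)
    | Sum.inr _, Sum.inr _ => 0

/-- The form with `ω(s^i, t^j) = -ω(t^j, s^i) = δ_{i+j,0}` and `ω(t^i, t^j) = ω(s^i, s^j) = 0`. -/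
def laurentForm : LinearMap.BilinForm k (LaurentPair k) :=
  (laurentBasis k).constr k fun x => (laurentBasis k).constr k fun y =>
    match x, y with
    | Sum.inr i, Sum.inl j => if i + j = 0 then 1 else 0
    | Sum.inl j, Sum.inr i => if i + j = 0 then -1 else 0
    | Sum.inl _, Sum.inl _ => 0
    | Sum.inr _, Sum.inr _ => 0

/-- The grading with degree `i` component `k t^(i+1) ⊕ k s^(i+1)`. -/
def laurentGrading : ℤ → Submodule k (LaurentPair k) :=
  fun i => Submodule.span k {tPow k (i + 1), sPow k (i + 1)}

instance laurentGradingDecomposition : DirectSum.Decomposition (laurentGrading k) :=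
  DirectSum.Decomposition.ofLinearMap (laurentGrading k)
    ((laurentBasis k).constr k fun x =>
      match x with
      | Sum.inl i => DirectSum.lof k ℤ (fun i => laurentGrading k i) (i - 1)
          ⟨tPow k i, Submodule.subset_span (by simp)⟩
      | Sum.inr i => DirectSum.lof k ℤ (fun i => laurentGrading k i) (i - 1)
          ⟨sPow k i, Submodule.subset_span (by simp)⟩)
    (by
      refine (laurentBasis k).ext fun x => ?_
      rcases x with i | i <;> simp [tPow, sPow])
    (by
      have hcast : ∀ (i j : ℤ) (x : LaurentPair k) (hi : x ∈ laurentGrading k i)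
          (hj : x ∈ laurentGrading k j), i = j →
          DirectSum.lof k ℤ (fun i => laurentGrading k i) i ⟨x, hi⟩ =
            DirectSum.lof k ℤ (fun i => laurentGrading k i) j ⟨x, hj⟩ := by
        rintro i _ x hi hj rfl
        rfl
      refine DirectSum.linearMap_ext k fun i => LinearMap.ext fun ⟨x, hx⟩ => ?_
      obtain ⟨a, b, rfl⟩ := Submodule.mem_span_pair.mp hx
      have hi : tPow k (i + 1) ∈ laurentGrading k i := Submodule.subset_span (by simp)
      have hi' : sPow k (i + 1) ∈ laurentGrading k i := Submodule.subset_span (by simp)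
      have hsum : (⟨a • tPow k (i + 1) + b • sPow k (i + 1), hx⟩ : laurentGrading k i) =
          a • ⟨tPow k (i + 1), hi⟩ + b • ⟨sPow k (i + 1), hi'⟩ := rfl
      rw [hsum]
      simp only [LinearMap.comp_apply, map_add, map_smul, DirectSum.coeLinearMap_lof]
      simp only [tPow, sPow, Module.Basis.constr_basis, LinearMap.id_apply]
      congr 2
      · exact hcast _ _ _ _ _ (by ring)
      · exact hcast _ _ _ _ _ (by ring))

end Laurent

end PermAffinization

end

open scoped TensorProduct LaurentPolynomial

noncomputable section

namespace PermAffinization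

/-! ### Evaluation of completed tensors on locally finite maps -/

section Evaluation

variable {k : Type*} [Field k]
variable {C D M N M' N' : Type*} [AddCommGroup C] [Module k C] [AddCommGroup D] [Module k D]
  [AddCommGroup M] [Module k M] [AddCommGroup N] [Module k N]
  [AddCommGroup M'] [Module k M'] [AddCommGroup N'] [Module k N']

/-! Everything is tested against `ω`. Contraction with `b` in `A`, the map `p ⊗ a ↦ ω(a, b) p` from
`P ⊗ A` to `P`, sees only finitely many degrees, so contractions may be applied to formal infinite
sums. Conversely, `ω` pairs `A_i` perfectly with `A_{m-i}`, so each entry of a completed tensor is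
determined by its contractions (`eq_of_contract`, `eq_of_contract₃`). The same dual bases give the
coproduct of `A` explicitly and show that it is unique.

Under contraction the structure maps of `P ⊗ A` become those of `P`. Contracting the cobracket of
`z` with `c, d` gives `σ Δ_P(z_{d⋄c}) - Δ_P(z_{c⋄d})`, where `z_b` is the contraction of `z` with
`b` (`evalTensor_contract_inducedCobracket`). Contracting `ad(p ⊗ a)` gives multiplications by `p`
after contractions with `a ⋄ c` and `c ⋄ a`, by invariance of `ω` (`contract_comp_inducedBracket`).
Hence each of the Jacobi, co-Jacobi and compatibility identities, contracted on pure tensors,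
becomes a sum of `φ(T(a, b, c)) v_T` over the twelve multilinear ternary monomials `T` in three
elements of `A`. Here `φ` is a functional coming from `ω`, and the `v_T` lie in a tensor power of
`P` and depend only on the structure of `P`.

Such a sum vanishes for every pre-Lie product as soon as the `v_T` form a combination of the three
instances of the pre-Lie identity: nine linear equations on twelve coefficients
(`TernaryCoeff.IsPreLie`). For the three families at hand these equations are together equivalent to
the perm bialgebra axioms (`isPermBialgebra_iff`); for the product alone this reflects the Koszul
duality between perm and pre-Lie. This proves (1).

For the converse in (2), the pre-Lie algebra must satisfy no further multilinear ternary identity.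
For the Laurent example nine evaluations on basis elements already force all nine equations, with
coefficients in any vector space (`TernaryCoeff.Vanishes.isPreLie`), so every completed Lie
bialgebra structure comes from a perm bialgebra. -/

/-- A linear map on `⨁ C_i` that vanishes on all but finitely many of the `C_i`. -/
def VanishesCofinitely (𝒞 : ℤ → Submodule k C) (f : C →ₗ[k] M) : Prop :=
  {i : ℤ | ∃ c ∈ 𝒞 i, f c ≠ 0}.Finite

theorem VanishesCofinitely.of_forall {𝒞 : ℤ → Submodule k C} {f : C →ₗ[k] M} (s : Finset ℤ)
    (h : ∀ i ∉ s, ∀ c ∈ 𝒞 i, f c = 0) : VanishesCofinitely 𝒞 f :=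
  s.finite_toSet.subset fun _ ⟨c, hc, hne⟩ => by_contra fun hi => hne (h _ hi c hc)

theorem VanishesCofinitely.exists_finset {𝒞 : ℤ → Submodule k C} {f : C →ₗ[k] M}
    (hf : VanishesCofinitely 𝒞 f) : ∃ s : Finset ℤ, ∀ i ∉ s, ∀ c ∈ 𝒞 i, f c = 0 :=
  ⟨hf.toFinset, fun _ hi c hc => by_contra fun hne => hi (hf.mem_toFinset.mpr ⟨c, hc, hne⟩)⟩

theorem VanishesCofinitely.add {𝒞 : ℤ → Submodule k C} {f g : C →ₗ[k] M}
    (hf : VanishesCofinitely 𝒞 f) (hg : VanishesCofinitely 𝒞 g) :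
    VanishesCofinitely 𝒞 (f + g) := by
  obtain ⟨s, hs⟩ := hf.exists_finset
  obtain ⟨t, ht⟩ := hg.exists_finset
  refine .of_forall (s ∪ t) fun i hi c hc => ?_
  rw [Finset.notMem_union] at hi
  simp [hs i hi.1 c hc, ht i hi.2 c hc]

theorem VanishesCofinitely.comp {𝒞 : ℤ → Submodule k C} {f : C →ₗ[k] M}
    (hf : VanishesCofinitely 𝒞 f) (φ : M →ₗ[k] M') : VanishesCofinitely 𝒞 (φ ∘ₗ f) := by
  obtain ⟨s, hs⟩ := hf.exists_finset
  exact .of_forall s fun i hi c hc => by simp [hs i hi c hc]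

/-- The formal sum of the `c ⊗ d` is sent to the sum of the `f c ⊗ g d`. -/
def evalTensor (f : C →ₗ[k] M) (g : D →ₗ[k] N) (x : ℤ × ℤ → C ⊗[k] D) : M ⊗[k] N :=
  ∑ᶠ ij : ℤ × ℤ, TensorProduct.map f g (x ij)

theorem completedMap_apply {ι κ : Type*} (f : C →ₗ[k] (ι → M)) (g : D →ₗ[k] (κ → N))
    (x : ℤ × ℤ → C ⊗[k] D) (s : ι × κ) :
    completedMap f g x s = evalTensor (LinearMap.proj s.1 ∘ₗ f) (LinearMap.proj s.2 ∘ₗ g) x :=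
  rfl

theorem map_eq_zero_of_left {U : Submodule k C} {V : Submodule k D} {f : C →ₗ[k] M}
    (g : D →ₗ[k] N) (hf : ∀ c ∈ U, f c = 0) {x : C ⊗[k] D}
    (hx : x ∈ LinearMap.range (TensorProduct.map U.subtype V.subtype)) :
    TensorProduct.map f g x = 0 := by
  obtain ⟨y, rfl⟩ := hx
  have : f ∘ₗ U.subtype = 0 := LinearMap.ext fun c => hf c c.2
  rw [← LinearMap.comp_apply, ← TensorProduct.map_comp, this, TensorProduct.map_zero_left,
    LinearMap.zero_apply]

theorem map_eq_zero_of_right {U : Submodule k C} {V : Submodule k D} (f : C →ₗ[k] M)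
    {g : D →ₗ[k] N} (hg : ∀ d ∈ V, g d = 0) {x : C ⊗[k] D}
    (hx : x ∈ LinearMap.range (TensorProduct.map U.subtype V.subtype)) :
    TensorProduct.map f g x = 0 := by
  obtain ⟨y, rfl⟩ := hx
  have : g ∘ₗ V.subtype = 0 := LinearMap.ext fun c => hg c c.2
  rw [← LinearMap.comp_apply, ← TensorProduct.map_comp, this, TensorProduct.map_zero_right,
    LinearMap.zero_apply]

variable {𝒞 : ℤ → Submodule k C} {𝒟 : ℤ → Submodule k D}

theorem entry_mem {x : ℤ × ℤ → C ⊗[k] D} (hx : x ∈ completedTensor 𝒞 𝒟) (ij : ℤ × ℤ) :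
    x ij ∈ LinearMap.range (TensorProduct.map (𝒞 ij.1).subtype (𝒟 ij.2).subtype) :=
  hx ij (Set.mem_univ _)

/-- Entries outside a finite box are killed by one of the two factors. As `finsum` is zero on
infinite supports, `evalTensor` is not additive in general; this reduction to one linear map on a
finite sum is the source of its additivity and functoriality. -/
theorem evalTensor_eq_sum {f : C →ₗ[k] M} {g : D →ₗ[k] N} {x : ℤ × ℤ → C ⊗[k] D}
    (hx : x ∈ completedTensor 𝒞 𝒟) {s t : Finset ℤ} (hs : ∀ i ∉ s, ∀ c ∈ 𝒞 i, f c = 0)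
    (ht : ∀ i ∉ t, ∀ d ∈ 𝒟 i, g d = 0) :
    evalTensor f g x = TensorProduct.map f g (∑ ij ∈ s ×ˢ t, x ij) := by
  rw [map_sum]
  refine finsum_eq_sum_of_support_subset _ fun ij hij => ?_
  by_contra h
  rw [Finset.mem_coe, Finset.mem_product, not_and_or] at h
  rcases h with h | h
  · exact hij (map_eq_zero_of_left g (hs _ h) (entry_mem hx ij))
  · exact hij (map_eq_zero_of_right f (ht _ h) (entry_mem hx ij))

theorem evalTensor_add_left {f f' : C →ₗ[k] M} {g : D →ₗ[k] N} {x : ℤ × ℤ → C ⊗[k] D}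
    (hx : x ∈ completedTensor 𝒞 𝒟) (hf : VanishesCofinitely 𝒞 f)
    (hf' : VanishesCofinitely 𝒞 f') (hg : VanishesCofinitely 𝒟 g) :
    evalTensor (f + f') g x = evalTensor f g x + evalTensor f' g x := by
  obtain ⟨s, hs⟩ := hf.exists_finset
  obtain ⟨s', hs'⟩ := hf'.exists_finset
  obtain ⟨t, ht⟩ := hg.exists_finset
  have h₁ : ∀ i ∉ s ∪ s', ∀ c ∈ 𝒞 i, f c = 0 := fun i hi =>
    hs i (fun h => hi (Finset.mem_union_left _ h))
  have h₂ : ∀ i ∉ s ∪ s', ∀ c ∈ 𝒞 i, f' c = 0 := fun i hi =>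
    hs' i (fun h => hi (Finset.mem_union_right _ h))
  rw [evalTensor_eq_sum hx h₁ ht, evalTensor_eq_sum hx h₂ ht,
    evalTensor_eq_sum hx (fun i hi c hc => by simp [h₁ i hi c hc, h₂ i hi c hc]) ht,
    TensorProduct.map_add_left, LinearMap.add_apply]

theorem evalTensor_add_right {f : C →ₗ[k] M} {g g' : D →ₗ[k] N} {x : ℤ × ℤ → C ⊗[k] D}
    (hx : x ∈ completedTensor 𝒞 𝒟) (hf : VanishesCofinitely 𝒞 f)
    (hg : VanishesCofinitely 𝒟 g) (hg' : VanishesCofinitely 𝒟 g') :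
    evalTensor f (g + g') x = evalTensor f g x + evalTensor f g' x := by
  obtain ⟨s, hs⟩ := hf.exists_finset
  obtain ⟨t, ht⟩ := hg.exists_finset
  obtain ⟨t', ht'⟩ := hg'.exists_finset
  have h₁ : ∀ i ∉ t ∪ t', ∀ c ∈ 𝒟 i, g c = 0 := fun i hi =>
    ht i (fun h => hi (Finset.mem_union_left _ h))
  have h₂ : ∀ i ∉ t ∪ t', ∀ c ∈ 𝒟 i, g' c = 0 := fun i hi =>
    ht' i (fun h => hi (Finset.mem_union_right _ h))
  rw [evalTensor_eq_sum hx hs h₁, evalTensor_eq_sum hx hs h₂,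
    evalTensor_eq_sum hx hs (fun i hi c hc => by simp [h₁ i hi c hc, h₂ i hi c hc]),
    TensorProduct.map_add_right, LinearMap.add_apply]

theorem evalTensor_add {f : C →ₗ[k] M} {g : D →ₗ[k] N} {x y : ℤ × ℤ → C ⊗[k] D}
    (hx : x ∈ completedTensor 𝒞 𝒟) (hy : y ∈ completedTensor 𝒞 𝒟)
    (hf : VanishesCofinitely 𝒞 f) (hg : VanishesCofinitely 𝒟 g) :
    evalTensor f g (x + y) = evalTensor f g x + evalTensor f g y := by
  obtain ⟨s, hs⟩ := hf.exists_finset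
  obtain ⟨t, ht⟩ := hg.exists_finset
  rw [evalTensor_eq_sum hx hs ht, evalTensor_eq_sum hy hs ht,
    evalTensor_eq_sum (add_mem hx hy) hs ht, ← map_add, ← Finset.sum_add_distrib]
  rfl

theorem evalTensor_sub {f : C →ₗ[k] M} {g : D →ₗ[k] N} {x y : ℤ × ℤ → C ⊗[k] D}
    (hx : x ∈ completedTensor 𝒞 𝒟) (hy : y ∈ completedTensor 𝒞 𝒟)
    (hf : VanishesCofinitely 𝒞 f) (hg : VanishesCofinitely 𝒟 g) :
    evalTensor f g (x - y) = evalTensor f g x - evalTensor f g y := by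
  rw [eq_sub_iff_add_eq, ← evalTensor_add (sub_mem hx hy) hy hf hg, sub_add_cancel]

theorem map_evalTensor {f : C →ₗ[k] M} {g : D →ₗ[k] N} {x : ℤ × ℤ → C ⊗[k] D}
    (hx : x ∈ completedTensor 𝒞 𝒟) (hf : VanishesCofinitely 𝒞 f)
    (hg : VanishesCofinitely 𝒟 g) (φ : M →ₗ[k] M') (ψ : N →ₗ[k] N') :
    TensorProduct.map φ ψ (evalTensor f g x) = evalTensor (φ ∘ₗ f) (ψ ∘ₗ g) x := by
  obtain ⟨s, hs⟩ := hf.exists_finset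
  obtain ⟨t, ht⟩ := hg.exists_finset
  rw [evalTensor_eq_sum hx hs ht,
    evalTensor_eq_sum hx (fun i hi c hc => by simp [hs i hi c hc])
      (fun i hi c hc => by simp [ht i hi c hc]), TensorProduct.map_comp, LinearMap.comp_apply]

theorem evalTensor_comp_left {f : C →ₗ[k] M} {g : D →ₗ[k] N} {x : ℤ × ℤ → C ⊗[k] D}
    (hx : x ∈ completedTensor 𝒞 𝒟) (hf : VanishesCofinitely 𝒞 f)
    (hg : VanishesCofinitely 𝒟 g) (φ : M →ₗ[k] M') :
    evalTensor (φ ∘ₗ f) g x = φ.rTensor N (evalTensor f g x) :=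
  (map_evalTensor hx hf hg φ LinearMap.id).symm

theorem evalTensor_comp_right {f : C →ₗ[k] M} {g : D →ₗ[k] N} {x : ℤ × ℤ → C ⊗[k] D}
    (hx : x ∈ completedTensor 𝒞 𝒟) (hf : VanishesCofinitely 𝒞 f)
    (hg : VanishesCofinitely 𝒟 g) (ψ : N →ₗ[k] N') :
    evalTensor f (ψ ∘ₗ g) x = ψ.lTensor M (evalTensor f g x) :=
  (map_evalTensor hx hf hg LinearMap.id ψ).symm

/-- Maps supported in a single degree only see one entry. -/
theorem evalTensor_eq_entry {f : C →ₗ[k] M} {g : D →ₗ[k] N} {x : ℤ × ℤ → C ⊗[k] D}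
    (hx : x ∈ completedTensor 𝒞 𝒟) {i j : ℤ} (hf : ∀ n ≠ i, ∀ c ∈ 𝒞 n, f c = 0)
    (hg : ∀ n ≠ j, ∀ d ∈ 𝒟 n, g d = 0) :
    evalTensor f g x = TensorProduct.map f g (x (i, j)) := by
  rw [evalTensor_eq_sum hx (s := {i}) (t := {j}) (by simpa using hf) (by simpa using hg)]
  simp

/-- The flip only permutes the index set and applies an isomorphism, and `finsum` respects both
without any finiteness. -/
theorem evalTensor_completedFlip (f g : C →ₗ[k] M) (x : completedTensor 𝒞 𝒞) :
    evalTensor f g (completedFlip 𝒞 x).1 = TensorProduct.comm k M M (evalTensor g f x.1) := by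
  have h (ij : ℤ × ℤ) : TensorProduct.map f g ((completedFlip 𝒞 x).1 ij) =
      TensorProduct.comm k M M (TensorProduct.map g f (x.1 ij.swap)) :=
    TensorProduct.map_comm f g (x.1 ij.swap)
  rw [evalTensor, finsum_congr h, evalTensor]
  exact (finsum_comp_equiv (Equiv.prodComm ℤ ℤ)
    (f := fun ij => TensorProduct.comm k M M (TensorProduct.map g f (x.1 ij)))).trans
    (AddEquiv.map_finsum (TensorProduct.comm k M M).toAddEquiv _).symm

/-- If the identity factors through `f ⊗ g` termwise, then an element killed by all `f ⊗ g`
vanishes. -/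
theorem eq_of_map_sum {ι κ : Type*} [Fintype ι] [Fintype κ] {e : ι → M →ₗ[k] C}
    {f : ι → C →ₗ[k] M} {e' : κ → N →ₗ[k] D} {f' : κ → D →ₗ[k] N} {x y : C ⊗[k] D}
    (hx : TensorProduct.map (∑ α, e α ∘ₗ f α) (∑ β, e' β ∘ₗ f' β) x = x)
    (hy : TensorProduct.map (∑ α, e α ∘ₗ f α) (∑ β, e' β ∘ₗ f' β) y = y)
    (h : ∀ α β, TensorProduct.map (f α) (f' β) x = TensorProduct.map (f α) (f' β) y) :
    x = y := by
  rw [← hx, ← hy]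
  -- Both copies of the identity are expanded, so that `z` is recovered from its images under the `f
  -- α ⊗ f' β`.
  have key (z : C ⊗[k] D) : TensorProduct.map (∑ α, e α ∘ₗ f α) (∑ β, e' β ∘ₗ f' β) z =
      ∑ α, ∑ β, TensorProduct.map (e α) (e' β) (TensorProduct.map (f α) (f' β) z) := by
    simp only [← TensorProduct.mapBilinear_apply, map_sum, LinearMap.sum_apply]
    rw [Finset.sum_comm]
    simp only [TensorProduct.mapBilinear_apply, TensorProduct.map_comp, LinearMap.comp_apply]
  rw [key, key]
  exact Finset.sum_congr rfl fun α _ => Finset.sum_congr rfl fun β _ => by rw [h]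

end Evaluation

/-! ### Homogeneous projections -/

section Projections

variable {k : Type*} [Field k] {C M : Type*} [AddCommGroup C] [Module k C]
  [AddCommGroup M] [Module k M]
  (𝒞 : ℤ → Submodule k C) [DirectSum.Decomposition 𝒞]

/-- The projection onto the component of degree `i`. -/
def homogeneousProj (i : ℤ) : C →ₗ[k] C := LinearMap.proj i ∘ₗ components 𝒞

variable {𝒞}

theorem homogeneousProj_of_mem {i : ℤ} {c : C} (hc : c ∈ 𝒞 i) : homogeneousProj 𝒞 i c = c :=
  DirectSum.decompose_of_mem_same 𝒞 hc

theorem homogeneousProj_of_mem_ne {i j : ℤ} {c : C} (hc : c ∈ 𝒞 j) (h : j ≠ i) :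
    homogeneousProj 𝒞 i c = 0 :=
  DirectSum.decompose_of_mem_ne 𝒞 hc h

theorem homogeneousProj_mem (i : ℤ) (c : C) : homogeneousProj 𝒞 i c ∈ 𝒞 i :=
  (DirectSum.decompose 𝒞 c i).2

theorem ext_of_graded {f g : C →ₗ[k] M} (h : ∀ i, ∀ c ∈ 𝒞 i, f c = g c) : f = g := by
  ext c
  induction c using DirectSum.Decomposition.inductionOn 𝒞 with
  | zero => simp
  | homogeneous c => exact h _ c c.2
  | add a b ha hb => rw [map_add, map_add, ha, hb]

theorem homogeneousProj_comp_self (i : ℤ) :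
    homogeneousProj 𝒞 i ∘ₗ homogeneousProj 𝒞 i = homogeneousProj 𝒞 i :=
  LinearMap.ext fun c => homogeneousProj_of_mem (homogeneousProj_mem i c)

/-- Lets the projections hidden in `components` be absorbed by a contraction supported in one
degree. -/
theorem comp_homogeneousProj {f : C →ₗ[k] M} {i : ℤ} (hf : ∀ n ≠ i, ∀ c ∈ 𝒞 n, f c = 0) :
    f ∘ₗ homogeneousProj 𝒞 i = f :=
  ext_of_graded (𝒞 := 𝒞) fun n c hc => by
    by_cases h : n = i
    · subst h; simp [homogeneousProj_of_mem hc]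
    · simp [homogeneousProj_of_mem_ne hc h, hf n h c hc]

theorem eq_zero_of_homogeneousProj {c : C} (h : ∀ i, homogeneousProj 𝒞 i c = 0) : c = 0 := by
  apply (DirectSum.decompose 𝒞).injective
  rw [DirectSum.decompose_zero]
  exact DFinsupp.ext fun i => Subtype.ext (h i)

theorem vanishesCofinitely_homogeneousProj (i : ℤ) :
    VanishesCofinitely 𝒞 (homogeneousProj 𝒞 i) :=
  .of_forall {i} fun n hn c hc => homogeneousProj_of_mem_ne hc (by simpa using hn)

theorem map_homogeneousProj_of_mem {i j : ℤ} {x : C ⊗[k] C}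
    (hx : x ∈ LinearMap.range (TensorProduct.map (𝒞 i).subtype (𝒞 j).subtype)) :
    TensorProduct.map (homogeneousProj 𝒞 i) (homogeneousProj 𝒞 j) x = x := by
  obtain ⟨y, rfl⟩ := hx
  rw [← LinearMap.comp_apply, ← TensorProduct.map_comp]
  congr 2 <;> exact LinearMap.ext fun c => homogeneousProj_of_mem c.2

end Projections

/-! ### Contraction with the form and the induced coproduct -/

section Quadratic

variable {k : Type*} [Field k] {A : Type*} [AddCommGroup A] [Module k A]
  {𝒜 : ℤ → Submodule k A} {dia : A →ₗ[k] A →ₗ[k] A}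
  {ω : LinearMap.BilinForm k A} {P : Type*} [AddCommGroup P] [Module k P]

theorem form_eq_zero_of_mem {m : ℤ}
    (hm : ∀ i j : ℤ, i + j ≠ m → ∀ a ∈ 𝒜 i, ∀ b ∈ 𝒜 j, ω a b = 0) {i j : ℤ} {b : A}
    (hb : b ∈ 𝒜 (m - i)) (hj : j ≠ i) {a : A} (ha : a ∈ 𝒜 j) : ω a b = 0 :=
  hm j (m - i) (by omega) a ha b hb

theorem map_eq_of_mem_tensorGrading {M : Type*} [AddCommGroup M] [Module k M]
    {f g : P ⊗[k] A →ₗ[k] M} {i : ℤ} (h : ∀ p, ∀ a ∈ 𝒜 i, f (p ⊗ₜ a) = g (p ⊗ₜ a))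
    {z : P ⊗[k] A} (hz : z ∈ tensorGrading P 𝒜 i) : f z = g z := by
  obtain ⟨y, rfl⟩ := hz
  induction y with
  | zero => simp
  | add x y hx hy => rw [map_add, map_add, map_add, hx, hy]
  | tmul p a => exact h p a a.2

theorem tmul_mem_tensorGrading (p : P) {i : ℤ} {a : A} (ha : a ∈ 𝒜 i) :
    p ⊗ₜ[k] a ∈ tensorGrading P 𝒜 i :=
  ⟨p ⊗ₜ ⟨a, ha⟩, rfl⟩

variable (P ω) in
/-- The map `p ⊗ a ↦ ω(a, b) p`. -/
def contract (b : A) : P ⊗[k] A →ₗ[k] P :=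
  (TensorProduct.rid k P).toLinearMap ∘ₗ (ω.flip b).lTensor P

@[simp]
theorem contract_tmul (b : A) (p : P) (a : A) : contract ω P b (p ⊗ₜ[k] a) = ω a b • p := by
  simp [contract]

theorem contract_add (b c : A) : contract ω P (b + c) = contract ω P b + contract ω P c := by
  ext; simp [add_smul]

theorem contract_zero : contract ω P (0 : A) = 0 := by
  ext; simp

theorem contract_eq_zero {m : ℤ}
    (hm : ∀ i j : ℤ, i + j ≠ m → ∀ a ∈ 𝒜 i, ∀ b ∈ 𝒜 j, ω a b = 0) {i : ℤ} {b : A}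
    (hb : b ∈ 𝒜 (m - i)) : ∀ n ≠ i, ∀ z ∈ tensorGrading P 𝒜 n, contract ω P b z = 0 := by
  intro n hn z hz
  refine (map_eq_of_mem_tensorGrading (g := 0) (fun p a ha => ?_) hz).trans (by simp)
  simp [form_eq_zero_of_mem hm hb hn ha]

variable [DirectSum.Decomposition 𝒜]

theorem IsQuadraticGradedPreLie.eq_zero_of_forall (hA : IsQuadraticGradedPreLie 𝒜 dia ω) {a : A}
    (h : ∀ b, ω a b = 0) : a = 0 :=
  hA.nondegenerate.1 a h

/-- An element of `A_i` is orthogonal to every component except `A_{m-i}`, so orthogonality to that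
one makes it zero by nondegeneracy, and the same holds on the other side. Two injective maps into
duals give a perfect pairing because `A_i` is finite-dimensional. -/
theorem IsQuadraticGradedPreLie.isPerfPair (hA : IsQuadraticGradedPreLie 𝒜 dia ω) {m : ℤ}
    (hm : ∀ i j : ℤ, i + j ≠ m → ∀ a ∈ 𝒜 i, ∀ b ∈ 𝒜 j, ω a b = 0) (i : ℤ) :
    (ω.domRestrict₁₂ (𝒜 i) (𝒜 (m - i))).IsPerfPair := by
  have := hA.finiteDimensional i
  refine LinearMap.IsPerfPair.of_injective ?_ ?_
  · rw [injective_iff_map_eq_zero]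
    intro a ha
    refine Subtype.ext (hA.eq_zero_of_forall fun b => ?_)
    have : ω a.1 = 0 := ext_of_graded (𝒞 := 𝒜) fun n b hb => by
      by_cases hn : n = m - i
      · subst hn; exact LinearMap.congr_fun ha ⟨b, hb⟩
      · exact hm i n (by omega) a a.2 b hb
    simp [this]
  · rw [injective_iff_map_eq_zero]
    intro b hb
    refine Subtype.ext (hA.nondegenerate.2 b.1 fun a => ?_)
    have : ω.flip b.1 = 0 := ext_of_graded (𝒞 := 𝒜) fun n a ha => by
      by_cases hn : n = i
      · subst hn; exact LinearMap.congr_fun hb ⟨a, ha⟩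
      · exact form_eq_zero_of_mem hm b.2 hn ha
    exact LinearMap.congr_fun this a

theorem IsQuadraticGradedPreLie.exists_dual_bases (hA : IsQuadraticGradedPreLie 𝒜 dia ω) {m : ℤ}
    (hm : ∀ i j : ℤ, i + j ≠ m → ∀ a ∈ 𝒜 i, ∀ b ∈ 𝒜 j, ω a b = 0) (i : ℤ) :
    ∃ (n : ℕ) (e f : Fin n → A), (∀ α, e α ∈ 𝒜 i) ∧ (∀ α, f α ∈ 𝒜 (m - i)) ∧
      (∀ a ∈ 𝒜 i, ∑ α, ω a (f α) • e α = a) ∧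
      (∀ b ∈ 𝒜 (m - i), ∑ α, ω (e α) b • f α = b) := by
  have := hA.finiteDimensional i
  have hp := hA.isPerfPair hm i
  set p := ω.domRestrict₁₂ (𝒜 i) (𝒜 (m - i))
  let B := Module.finBasis k (𝒜 i)
  -- The `ω`-dual basis: pairing with `f α` is the `α`-th coordinate on `A_i`.
  let f : Fin _ → 𝒜 (m - i) := fun α => p.flip.toPerfPair.symm (B.coord α)
  have hf (a : 𝒜 i) (α) : p a (f α) = B.repr a α :=
    LinearMap.apply_toPerfPair_flip p (B.coord α) a
  have he (a : 𝒜 i) : ∑ α, p a (f α) • B α = a := by simp_rw [hf]; exact B.sum_repr a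
  refine ⟨_, fun α => B α, fun α => f α, fun α => (B α).2, fun α => (f α).2, ?_, ?_⟩
  · intro a ha
    have := congrArg Subtype.val (he ⟨a, ha⟩)
    simp only [Submodule.coe_sum, Submodule.coe_smul] at this
    exact this
  · intro b hb
    have : ∑ α, p (B α) ⟨b, hb⟩ • f α = ⟨b, hb⟩ := by
      -- Elements of `A_{m-i}` are distinguished by pairing with `A_i`, where the argument is
      -- expanded in the basis.
      apply hp.bijective_right.1
      ext a
      conv_rhs => rw [← he a]
      simp only [map_sum, map_smul, LinearMap.sum_apply, LinearMap.smul_apply,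
        LinearMap.flip_apply, smul_eq_mul]
      exact Finset.sum_congr rfl fun α _ => mul_comm _ _
    have := congrArg Subtype.val this
    simp only [Submodule.coe_sum, Submodule.coe_smul] at this
    exact this

theorem vanishesCofinitely_contract (hω : ∃ m : ℤ, ∀ i j : ℤ, i + j ≠ m → ∀ a ∈ 𝒜 i, ∀ b ∈ 𝒜 j,
    ω a b = 0) (b : A) : VanishesCofinitely (tensorGrading P 𝒜) (contract ω P b) := by
  obtain ⟨m, hm⟩ := hω
  induction b using DirectSum.Decomposition.inductionOn 𝒜 with
  | zero => rw [contract_zero]; exact .of_forall ∅ (by simp)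
  | @homogeneous i b =>
    have hb : (b : A) ∈ 𝒜 (m - (m - i)) := by rw [sub_sub_cancel]; exact b.2
    exact .of_forall {m - i} fun n hn => contract_eq_zero hm hb n (by simpa using hn)
  | add a b ha hb => rw [contract_add]; exact ha.add hb

theorem vanishesCofinitely_form (hω : ∃ m : ℤ, ∀ i j : ℤ, i + j ≠ m → ∀ a ∈ 𝒜 i, ∀ b ∈ 𝒜 j,
    ω a b = 0) (b : A) : VanishesCofinitely 𝒜 (ω.flip b) := by
  obtain ⟨m, hm⟩ := hω
  induction b using DirectSum.Decomposition.inductionOn 𝒜 with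
  | zero => exact .of_forall ∅ (by simp)
  | @homogeneous i b =>
    exact .of_forall {m - i} fun n hn a ha =>
      hm n i (fun h => hn (by simp [← h])) a ha b b.2
  | add a b ha hb => rw [map_add]; exact ha.add hb

/-- Dual bases factor the projection through finitely many functionals `ω(-, f α)`, which is the
shape of identity required by `eq_of_map_sum`. -/
theorem homogeneousProj_eq_sum {m : ℤ}
    (hm : ∀ i j : ℤ, i + j ≠ m → ∀ a ∈ 𝒜 i, ∀ b ∈ 𝒜 j, ω a b = 0) {i : ℤ} {n : ℕ}
    {e f : Fin n → A} (hf : ∀ α, f α ∈ 𝒜 (m - i))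
    (h : ∀ a ∈ 𝒜 i, ∑ α, ω a (f α) • e α = a) :
    homogeneousProj 𝒜 i = ∑ α, LinearMap.toSpanSingleton k A (e α) ∘ₗ ω.flip (f α) := by
  refine ext_of_graded (𝒞 := 𝒜) fun j a ha => ?_
  by_cases hj : j = i
  · subst hj
    rw [homogeneousProj_of_mem ha]
    simpa using (h a ha).symm
  · rw [homogeneousProj_of_mem_ne ha hj]
    simp [form_eq_zero_of_mem hm (hf _) hj ha]

theorem homogeneousProj_tensorGrading_eq_sum {m : ℤ}
    (hm : ∀ i j : ℤ, i + j ≠ m → ∀ a ∈ 𝒜 i, ∀ b ∈ 𝒜 j, ω a b = 0) {i : ℤ} {n : ℕ}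
    {e f : Fin n → A} (hf : ∀ α, f α ∈ 𝒜 (m - i))
    (h : ∀ a ∈ 𝒜 i, ∑ α, ω a (f α) • e α = a) :
    homogeneousProj (tensorGrading P 𝒜) i =
      ∑ α, (TensorProduct.mk k P A).flip (e α) ∘ₗ contract ω P (f α) := by
  refine ext_of_graded (𝒞 := tensorGrading P 𝒜) fun j z hz => ?_
  refine map_eq_of_mem_tensorGrading (fun p a ha => ?_) hz
  by_cases hj : j = i
  · subst hj
    rw [homogeneousProj_of_mem (tmul_mem_tensorGrading p ha)]
    simp_rw [LinearMap.sum_apply, LinearMap.comp_apply, contract_tmul, LinearMap.flip_apply,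
      TensorProduct.mk_apply, TensorProduct.smul_tmul, ← TensorProduct.tmul_sum]
    rw [h a ha]
  · rw [homogeneousProj_of_mem_ne (tmul_mem_tensorGrading p ha) hj]
    simp [form_eq_zero_of_mem hm (hf _) hj ha]

theorem IsQuadraticGradedPreLie.eq_of_form (hA : IsQuadraticGradedPreLie 𝒜 dia ω) {m : ℤ}
    (hm : ∀ i j : ℤ, i + j ≠ m → ∀ a ∈ 𝒜 i, ∀ b ∈ 𝒜 j, ω a b = 0) {i j : ℤ} {x y : A ⊗[k] A}
    (hx : TensorProduct.map (homogeneousProj 𝒜 i) (homogeneousProj 𝒜 j) x = x)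
    (hy : TensorProduct.map (homogeneousProj 𝒜 i) (homogeneousProj 𝒜 j) y = y)
    (h : ∀ c ∈ 𝒜 (m - i), ∀ d ∈ 𝒜 (m - j), TensorProduct.map (ω.flip c) (ω.flip d) x =
      TensorProduct.map (ω.flip c) (ω.flip d) y) : x = y := by
  obtain ⟨n, e, f, -, hf, hef, -⟩ := hA.exists_dual_bases hm i
  obtain ⟨n', e', f', -, hf', hef', -⟩ := hA.exists_dual_bases hm j
  rw [homogeneousProj_eq_sum hm hf hef, homogeneousProj_eq_sum hm hf' hef'] at hx hy
  exact eq_of_map_sum hx hy fun α β => h _ (hf α) _ (hf' β)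

/-- The projections fix `x` and `y` and factor through contractions. This is how identities between
entries of completed tensors are reduced to identities in `P ⊗ P`. -/
theorem IsQuadraticGradedPreLie.eq_of_contract (hA : IsQuadraticGradedPreLie 𝒜 dia ω) {m : ℤ}
    (hm : ∀ i j : ℤ, i + j ≠ m → ∀ a ∈ 𝒜 i, ∀ b ∈ 𝒜 j, ω a b = 0) {i j : ℤ}
    {x y : (P ⊗[k] A) ⊗[k] (P ⊗[k] A)}
    (hx : TensorProduct.map (homogeneousProj (tensorGrading P 𝒜) i)
      (homogeneousProj (tensorGrading P 𝒜) j) x = x)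
    (hy : TensorProduct.map (homogeneousProj (tensorGrading P 𝒜) i)
      (homogeneousProj (tensorGrading P 𝒜) j) y = y)
    (h : ∀ c ∈ 𝒜 (m - i), ∀ d ∈ 𝒜 (m - j),
      TensorProduct.map (contract ω P c) (contract ω P d) x =
        TensorProduct.map (contract ω P c) (contract ω P d) y) : x = y := by
  obtain ⟨n, e, f, -, hf, hef, -⟩ := hA.exists_dual_bases hm i
  obtain ⟨n', e', f', -, hf', hef', -⟩ := hA.exists_dual_bases hm j
  rw [homogeneousProj_tensorGrading_eq_sum hm hf hef,
    homogeneousProj_tensorGrading_eq_sum hm hf' hef'] at hx hy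
  exact eq_of_map_sum hx hy fun α β => h _ (hf α) _ (hf' β)

theorem IsQuadraticGradedPreLie.eq_of_contract₃ (hA : IsQuadraticGradedPreLie 𝒜 dia ω) {m : ℤ}
    (hm : ∀ i j : ℤ, i + j ≠ m → ∀ a ∈ 𝒜 i, ∀ b ∈ 𝒜 j, ω a b = 0) {i j l : ℤ}
    {x y : (P ⊗[k] A) ⊗[k] ((P ⊗[k] A) ⊗[k] (P ⊗[k] A))}
    (hx : TensorProduct.map (homogeneousProj (tensorGrading P 𝒜) i)
      (TensorProduct.map (homogeneousProj (tensorGrading P 𝒜) j)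
        (homogeneousProj (tensorGrading P 𝒜) l)) x = x)
    (hy : TensorProduct.map (homogeneousProj (tensorGrading P 𝒜) i)
      (TensorProduct.map (homogeneousProj (tensorGrading P 𝒜) j)
        (homogeneousProj (tensorGrading P 𝒜) l)) y = y)
    (h : ∀ b ∈ 𝒜 (m - i), ∀ c ∈ 𝒜 (m - j), ∀ d ∈ 𝒜 (m - l),
      TensorProduct.map (contract ω P b)
          (TensorProduct.map (contract ω P c) (contract ω P d)) x =
        TensorProduct.map (contract ω P b)
          (TensorProduct.map (contract ω P c) (contract ω P d)) y) : x = y := by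
  obtain ⟨n, e, f, -, hf, hef, -⟩ := hA.exists_dual_bases hm i
  obtain ⟨n', e', f', -, hf', hef', -⟩ := hA.exists_dual_bases hm j
  obtain ⟨n'', e'', f'', -, hf'', hef'', -⟩ := hA.exists_dual_bases hm l
  -- The last two factors are treated as one, with index set the pairs of dual basis indices, so
  -- that the two-factor criterion applies.
  have key : TensorProduct.map (homogeneousProj (tensorGrading P 𝒜) j)
      (homogeneousProj (tensorGrading P 𝒜) l) = ∑ αβ : Fin n' × Fin n'',
        TensorProduct.map ((TensorProduct.mk k P A).flip (e' αβ.1))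
          ((TensorProduct.mk k P A).flip (e'' αβ.2)) ∘ₗ
        TensorProduct.map (contract ω P (f' αβ.1)) (contract ω P (f'' αβ.2)) := by
    rw [homogeneousProj_tensorGrading_eq_sum hm hf' hef',
      homogeneousProj_tensorGrading_eq_sum hm hf'' hef'', Fintype.sum_prod_type]
    simp only [← TensorProduct.mapBilinear_apply, map_sum, LinearMap.sum_apply]
    simp only [TensorProduct.mapBilinear_apply, TensorProduct.map_comp]
    exact Finset.sum_comm
  rw [key, homogeneousProj_tensorGrading_eq_sum hm hf hef] at hx hy
  exact eq_of_map_sum hx hy fun α β => h _ (hf α) _ (hf' β.1) _ (hf'' β.2)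

theorem IsQuadraticGradedPreLie.eq_zero_of_contract (hA : IsQuadraticGradedPreLie 𝒜 dia ω)
    {z : P ⊗[k] A} (h : ∀ d, contract ω P d z = 0) : z = 0 := by
  obtain ⟨m, hm⟩ := hA.graded
  refine eq_zero_of_homogeneousProj (𝒞 := tensorGrading P 𝒜) fun i => ?_
  obtain ⟨n, e, f, -, hf, hef, -⟩ := hA.exists_dual_bases hm i
  rw [homogeneousProj_tensorGrading_eq_sum hm hf hef]
  simp [h]

end Quadratic

/-! ### Existence and uniqueness of the coproduct dual to the product of `A` -/

section Coproduct

variable {k : Type*} [Field k] {A : Type*} [AddCommGroup A] [Module k A]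
  {𝒜 : ℤ → Submodule k A} [DirectSum.Decomposition 𝒜] {dia : A →ₗ[k] A →ₗ[k] A}
  {ω : LinearMap.BilinForm k A} {P : Type*} [AddCommGroup P] [Module k P]

/-- Allows `LinearMap.mul'` to be moved across a `finsum` with no hypothesis on its support, and to
be cancelled in uniqueness arguments. -/
theorem mul'_injective : Function.Injective (LinearMap.mul' k k) := by
  have : LinearMap.mul' k k = (TensorProduct.lid k k).toLinearMap := by ext; simp
  rw [this]
  exact (TensorProduct.lid k k).injective

omit [DirectSum.Decomposition 𝒜] in
theorem completedPairing_eq (x : ℤ × ℤ → A ⊗[k] A) (b c : A) :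
    completedPairing ω x b c = LinearMap.mul' k k (evalTensor (ω.flip b) (ω.flip c) x) :=
  ((LinearMap.mul' k k).toAddMonoidHom.map_finsum_of_injective mul'_injective _).symm

theorem completedPairing_add_left (hω : ∃ m : ℤ, ∀ i j : ℤ, i + j ≠ m → ∀ a ∈ 𝒜 i, ∀ b ∈ 𝒜 j,
    ω a b = 0) {x : ℤ × ℤ → A ⊗[k] A} (hx : x ∈ completedTensor 𝒜 𝒜) (b b' c : A) :
    completedPairing ω x (b + b') c = completedPairing ω x b c + completedPairing ω x b' c := by
  simp only [completedPairing_eq, map_add]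
  rw [evalTensor_add_left hx (vanishesCofinitely_form hω b) (vanishesCofinitely_form hω b')
    (vanishesCofinitely_form hω c), map_add]

theorem completedPairing_add_right (hω : ∃ m : ℤ, ∀ i j : ℤ, i + j ≠ m → ∀ a ∈ 𝒜 i, ∀ b ∈ 𝒜 j,
    ω a b = 0) {x : ℤ × ℤ → A ⊗[k] A} (hx : x ∈ completedTensor 𝒜 𝒜) (b c c' : A) :
    completedPairing ω x b (c + c') = completedPairing ω x b c + completedPairing ω x b c' := by
  simp only [completedPairing_eq, map_add]
  rw [evalTensor_add_right hx (vanishesCofinitely_form hω b) (vanishesCofinitely_form hω c)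
    (vanishesCofinitely_form hω c'), map_add]

omit [DirectSum.Decomposition 𝒜] in
theorem completedPairing_zero_left (x : ℤ × ℤ → A ⊗[k] A) (c : A) :
    completedPairing ω x 0 c = 0 := by
  simp [completedPairing]

omit [DirectSum.Decomposition 𝒜] in
theorem completedPairing_zero_right (x : ℤ × ℤ → A ⊗[k] A) (b : A) :
    completedPairing ω x b 0 = 0 := by
  simp [completedPairing]

omit [DirectSum.Decomposition 𝒜] in
theorem completedPairing_of_mem {m : ℤ}
    (hm : ∀ i j : ℤ, i + j ≠ m → ∀ a ∈ 𝒜 i, ∀ b ∈ 𝒜 j, ω a b = 0) {i j : ℤ}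
    {x : ℤ × ℤ → A ⊗[k] A} (hx : x ∈ completedTensor 𝒜 𝒜) {b c : A}
    (hb : b ∈ 𝒜 (m - i)) (hc : c ∈ 𝒜 (m - j)) :
    completedPairing ω x b c =
      LinearMap.mul' k k (TensorProduct.map (ω.flip b) (ω.flip c) (x (i, j))) := by
  rw [completedPairing_eq, evalTensor_eq_entry hx
    (fun n hn a ha => form_eq_zero_of_mem hm hb hn ha)
    (fun n hn a ha => form_eq_zero_of_mem hm hc hn ha)]

/-- Pairing with homogeneous `b` and `c` isolates a single entry, and such pairings separate the
elements of `A_i ⊗ A_j`. -/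
theorem IsQuadraticGradedPreLie.inducedCoproduct_unique
    (hA : IsQuadraticGradedPreLie 𝒜 dia ω) {Δ Δ' : A →ₗ[k] completedTensor 𝒜 𝒜}
    (h : IsInducedCoproduct 𝒜 dia ω Δ) (h' : IsInducedCoproduct 𝒜 dia ω Δ') : Δ = Δ' := by
  obtain ⟨m, hm⟩ := hA.graded
  refine LinearMap.ext fun a => Subtype.ext (funext fun ⟨i, j⟩ => ?_)
  refine hA.eq_of_form hm (map_homogeneousProj_of_mem (entry_mem (Δ a).2 _))
    (map_homogeneousProj_of_mem (entry_mem (Δ' a).2 _)) fun c hc d hd => mul'_injective ?_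
  rw [← completedPairing_of_mem hm (Δ a).2 hc hd, ← completedPairing_of_mem hm (Δ' a).2 hc hd,
    h a c d, h' a c d]

theorem IsQuadraticGradedPreLie.exists_inducedCoproduct
    (hA : IsQuadraticGradedPreLie 𝒜 dia ω) :
    ∃ Δ : A →ₗ[k] completedTensor 𝒜 𝒜, IsInducedCoproduct 𝒜 dia ω Δ := by
  obtain ⟨m, hm⟩ := hA.graded
  choose n e f he hf hef hfe using hA.exists_dual_bases hm
  -- The formula is forced by the dual bases: the `(i, j)` entry of `Δ a` is `-∑ ω(a, f_α ⋄ f_β) e_α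
  -- ⊗ e_β`.
  let Δ : A →ₗ[k] completedTensor 𝒜 𝒜 := LinearMap.codRestrict _
    (LinearMap.pi fun ij => ∑ α, ∑ β,
      LinearMap.toSpanSingleton k (A ⊗[k] A) (-(e ij.1 α ⊗ₜ e ij.2 β)) ∘ₗ
        ω.flip (dia (f ij.1 α) (f ij.2 β))) (by
      intro a ij _
      simp only [LinearMap.pi_apply, LinearMap.sum_apply]
      refine sum_mem fun α _ => sum_mem fun β _ => ?_
      change ω a (dia (f ij.1 α) (f ij.2 β)) • -(e ij.1 α ⊗ₜ[k] e ij.2 β) ∈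
        LinearMap.range (TensorProduct.map (𝒜 ij.1).subtype (𝒜 ij.2).subtype)
      exact Submodule.smul_mem _ _ (Submodule.neg_mem _ ⟨⟨_, he _ α⟩ ⊗ₜ ⟨_, he _ β⟩, rfl⟩))
  have hΔ (a : A) (i j : ℤ) : (Δ a).1 (i, j) =
      ∑ α, ∑ β, ω a (dia (f i α) (f j β)) • -(e i α ⊗ₜ[k] e j β) := by
    change (∑ α, ∑ β, LinearMap.toSpanSingleton k (A ⊗[k] A) (-(e i α ⊗ₜ e j β)) ∘ₗ
      ω.flip (dia (f i α) (f j β))) a = _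
    simp only [LinearMap.sum_apply]
    rfl
  refine ⟨Δ, fun a b c => ?_⟩
  induction b using DirectSum.Decomposition.inductionOn 𝒜 with
  | zero => simp [completedPairing_zero_left]
  | add b b' hb hb' =>
    rw [completedPairing_add_left hA.graded (Δ a).2, hb, hb']
    simp [add_comm]
  | @homogeneous i b =>
    induction c using DirectSum.Decomposition.inductionOn 𝒜 with
    | zero => simp [completedPairing_zero_right]
    | add c c' hc hc' =>
      rw [completedPairing_add_right hA.graded (Δ a).2, hc, hc']
      simp [add_comm]
    | @homogeneous j c =>
      -- Elements of degrees `i` and `j` pair with the entry of index `(m - i, m - j)`; expanding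
      -- them in the `f` basis there matches the defining formula.
      have hb : (b : A) ∈ 𝒜 (m - (m - i)) := by rw [sub_sub_cancel]; exact b.2
      have hc : (c : A) ∈ 𝒜 (m - (m - j)) := by rw [sub_sub_cancel]; exact c.2
      rw [completedPairing_of_mem hm (Δ a).2 hb hc, hΔ]
      conv_rhs => rw [← hfe _ _ hb, ← hfe _ _ hc]
      simp only [map_sum, map_smul, map_neg, LinearMap.sum_apply, LinearMap.smul_apply,
        TensorProduct.map_tmul, LinearMap.mul'_apply, LinearMap.BilinForm.flip_apply, smul_eq_mul,
        ← Finset.sum_neg_distrib, Finset.mul_sum]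
      rw [Finset.sum_comm]
      exact Finset.sum_congr rfl fun α _ => Finset.sum_congr rfl fun β _ => by ring

/-! ### Contractions of the induced bracket and cobracket -/

omit [DirectSum.Decomposition 𝒜] in
theorem map_contract_tensorTensorTensorComm (u : P ⊗[k] P) (x : A ⊗[k] A) (b c : A) :
    TensorProduct.map (contract ω P b) (contract ω P c)
      (TensorProduct.tensorTensorTensorComm k P P A A (u ⊗ₜ x)) =
      LinearMap.mul' k k (TensorProduct.map (ω.flip b) (ω.flip c) x) • u := by
  induction u with
  | zero => simp
  | add u v hu hv => simp only [TensorProduct.add_tmul, map_add, hu, hv, smul_add]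
  | tmul p q =>
    induction x with
    | zero => simp
    | add x y hx hy => simp only [TensorProduct.tmul_add, map_add, hx, hy, add_smul]
    | tmul a a' =>
      simp only [TensorProduct.tensorTensorTensorComm_tmul, TensorProduct.map_tmul, contract_tmul,
        LinearMap.mul'_apply, LinearMap.BilinForm.flip_apply, TensorProduct.smul_tmul_smul]

omit [DirectSum.Decomposition 𝒜] in
theorem evalTensor_contract_bullet (u : P ⊗[k] P) (x : completedTensor 𝒜 𝒜) (b c : A) :
    evalTensor (contract ω P b) (contract ω P c) (bullet 𝒜 u x).1 =
      completedPairing ω x b c • u := by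
  rw [completedPairing, finsum_smul]
  exact finsum_congr fun ij => map_contract_tensorTensorTensorComm u (x.1 ij) b c

variable {ΔP : P →ₗ[k] P ⊗[k] P} {ΔA : A →ₗ[k] completedTensor 𝒜 𝒜}

/-- On `p ⊗ a`, contracting `Δ_P(p) • Δ_A(a)` gives `-ω(a, c ⋄ d) Δ_P(p)` by the definition of
`Δ_A`, and the flip exchanges `c` and `d`. The cobracket of `P ⊗ A` enters the later computations
only through this formula. -/
theorem evalTensor_contract_inducedCobracket (hω : ∃ m : ℤ, ∀ i j : ℤ, i + j ≠ m →
    ∀ a ∈ 𝒜 i, ∀ b ∈ 𝒜 j, ω a b = 0) (hΔ : IsInducedCoproduct 𝒜 dia ω ΔA) (c d : A)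
    (z : P ⊗[k] A) :
    evalTensor (contract ω P c) (contract ω P d) (inducedCobracket ΔP ΔA z).1 =
      TensorProduct.comm k P P (ΔP (contract ω P (dia d c) z)) -
        ΔP (contract ω P (dia c d) z) := by
  have hf := vanishesCofinitely_contract (P := P) hω
  induction z with
  | zero => simp [evalTensor]
  | add x y hx hy =>
    rw [map_add, Submodule.coe_add, evalTensor_add (Subtype.prop _) (Subtype.prop _) (hf c) (hf d),
      hx, hy]
    simp only [map_add]
    abel
  | tmul p a =>
    have : inducedCobracket ΔP ΔA (p ⊗ₜ a) = bullet 𝒜 (ΔP p) (ΔA a) -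
      completedFlip (tensorGrading P 𝒜) (bullet 𝒜 (ΔP p) (ΔA a)) := rfl
    rw [this, Submodule.coe_sub, evalTensor_sub (Subtype.prop _) (Subtype.prop _) (hf c) (hf d),
      evalTensor_completedFlip, evalTensor_contract_bullet, evalTensor_contract_bullet, hΔ, hΔ]
    simp only [contract_tmul, map_smul]
    module

theorem map_contract_inducedCobracket {m : ℤ}
    (hm : ∀ i j : ℤ, i + j ≠ m → ∀ a ∈ 𝒜 i, ∀ b ∈ 𝒜 j, ω a b = 0)
    (hΔ : IsInducedCoproduct 𝒜 dia ω ΔA) {i j : ℤ} {c d : A}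
    (hc : c ∈ 𝒜 (m - i)) (hd : d ∈ 𝒜 (m - j)) (z : P ⊗[k] A) :
    TensorProduct.map (contract ω P c) (contract ω P d) ((inducedCobracket ΔP ΔA z).1 (i, j)) =
      TensorProduct.comm k P P (ΔP (contract ω P (dia d c) z)) -
        ΔP (contract ω P (dia c d) z) := by
  rw [← evalTensor_contract_inducedCobracket ⟨m, hm⟩ hΔ,
    evalTensor_eq_entry (Subtype.prop _) (contract_eq_zero hm hc) (contract_eq_zero hm hd)]

theorem IsQuadraticGradedPreLie.inducedCobracket_columnFinite
    (hA : IsQuadraticGradedPreLie 𝒜 dia ω) (hΔ : IsInducedCoproduct 𝒜 dia ω ΔA) :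
    IsColumnFinite (tensorGrading P 𝒜)
      ((completedTensor (tensorGrading P 𝒜) (tensorGrading P 𝒜)).subtype ∘ₗ
        inducedCobracket ΔP ΔA) := by
  obtain ⟨m, hm⟩ := hA.graded
  rintro ⟨i, j⟩
  -- Contracting the `(i, j)` entry uses products of degree `(m - i) + (m - j)`, which pair
  -- nontrivially only with degree `i + j - m`.
  refine (Set.finite_singleton (i + j - m)).subset fun n ⟨z, hz, hne⟩ => ?_
  by_contra hn
  refine hne (hA.eq_of_contract hm
    (map_homogeneousProj_of_mem (entry_mem (inducedCobracket ΔP ΔA z).2 _)) (by simp)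
    fun c hc d hd => ?_)
  rw [map_zero]
  refine (map_contract_inducedCobracket hm hΔ hc hd z).trans ?_
  have h : n ≠ i + j - m := hn
  rw [contract_eq_zero hm (i := i + j - m) (by convert hA.mem _ _ _ _ hd hc using 2; ring) n h z hz,
    contract_eq_zero hm (i := i + j - m) (by convert hA.mem _ _ _ _ hc hd using 2; ring) n h z hz]
  simp

theorem idSubFlip_add_completedFlip {L : Type*} [AddCommGroup L] [Module k L]
    {ℒ : ℤ → Submodule k L} (x : completedTensor ℒ ℒ) :
    idSubFlip ℒ x + completedFlip ℒ (idSubFlip ℒ x) = 0 := by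
  have : completedFlip ℒ (completedFlip ℒ x) = x :=
    Subtype.ext (funext fun ij => (TensorProduct.comm k L L).right_inv (x.1 ij))
  simp [idSubFlip, this]

omit [DirectSum.Decomposition 𝒜] in
theorem inducedBracket_tmul (mul : P →ₗ[k] P →ₗ[k] P) (p q : P) (a b : A) :
    inducedBracket mul dia (p ⊗ₜ a) (q ⊗ₜ b) =
      mul p q ⊗ₜ[k] dia a b - mul q p ⊗ₜ[k] dia b a := rfl

omit [DirectSum.Decomposition 𝒜] in
theorem inducedBracket_self (mul : P →ₗ[k] P →ₗ[k] P) (z : P ⊗[k] A) :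
    inducedBracket mul dia z z = 0 :=
  sub_self _

/-- Right multiplications are self-adjoint: apply invariance to both sides, using skew-symmetry for
the second. -/
theorem IsQuadraticGradedPreLie.form_left_swap (hA : IsQuadraticGradedPreLie 𝒜 dia ω)
    (a b c : A) : ω (dia a b) c = ω a (dia c b) := by
  rw [hA.skew a, hA.invariant c b a, hA.invariant a b c]
  simp

/-- Invariance moves left and right multiplication by `a` onto `c`, which turns `ad(p ⊗ a)` into
operators on `P` applied after contractions. -/
theorem IsQuadraticGradedPreLie.contract_comp_inducedBracket
    (hA : IsQuadraticGradedPreLie 𝒜 dia ω) (mul : P →ₗ[k] P →ₗ[k] P) (p : P) (a c : A) :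
    contract ω P c ∘ₗ inducedBracket mul dia (p ⊗ₜ a) =
      (-mul p) ∘ₗ contract ω P (dia a c) +
        (mul p - mul.flip p) ∘ₗ contract ω P (dia c a) := by
  ext q b
  simp only [TensorProduct.AlgebraTensorModule.curry_apply, LinearMap.restrictScalars_self,
    TensorProduct.curry_apply, LinearMap.comp_apply, LinearMap.add_apply, inducedBracket_tmul,
    map_sub, contract_tmul, hA.invariant a b c, hA.form_left_swap b a c, LinearMap.sub_apply,
    LinearMap.neg_apply, map_smul, LinearMap.flip_apply]
  module

theorem inducedBracket_ad_columnFinite (hA : IsGradedPreLie 𝒜 dia)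
    (mul : P →ₗ[k] P →ₗ[k] P) (z : P ⊗[k] A) : IsColumnFinite (tensorGrading P 𝒜)
      (components (tensorGrading P 𝒜) ∘ₗ inducedBracket mul dia z) := by
  intro s
  change VanishesCofinitely (tensorGrading P 𝒜)
    (homogeneousProj (tensorGrading P 𝒜) s ∘ₗ inducedBracket mul dia z)
  induction z with
  | zero => exact .of_forall ∅ (by simp)
  | add x y hx hy => rw [map_add, LinearMap.comp_add]; exact hx.add hy
  | tmul p a =>
    induction a using DirectSum.Decomposition.inductionOn 𝒜 with
    | zero => exact .of_forall ∅ (by simp)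
    | add a b ha hb =>
      rw [TensorProduct.tmul_add, map_add, LinearMap.comp_add]
      exact ha.add hb
    | @homogeneous i a =>
      -- Bracketing with an element of degree `i` shifts degrees by `i`, so the component of degree
      -- `s` comes only from degree `s - i`.
      refine .of_forall {s - i} fun n hn z hz => ?_
      refine (map_eq_of_mem_tensorGrading (g := 0) (fun q b hb => ?_) hz).trans (by simp)
      have hn' : n ≠ s - i := by simpa using hn
      rw [LinearMap.comp_apply, inducedBracket_tmul, map_sub,
        homogeneousProj_of_mem_ne (tmul_mem_tensorGrading _ (hA.mem _ _ _ _ a.2 hb)) (by omega),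
        homogeneousProj_of_mem_ne (tmul_mem_tensorGrading _ (hA.mem _ _ _ _ hb a.2)) (by omega)]
      simp

end Coproduct

/-! ### Linear combinations of ternary pre-Lie monomials -/

/-- Coefficients of the twelve multilinear monomials in `a, b, c`; for instance `ab_c` belongs to
`(a ⋄ b) ⋄ c` and `a_bc` to `a ⋄ (b ⋄ c)`. -/
structure TernaryCoeff (V : Type*) where
  (ab_c ba_c bc_a cb_a ac_b ca_b a_bc b_ac b_ca c_ba a_cb c_ab : V)

namespace TernaryCoeff

variable {k : Type*} [Field k] {V : Type*} [AddCommGroup V] [Module k V]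
  {A : Type*} [AddCommGroup A] [Module k A]

/-- The sum of the `φ(T(a, b, c)) v_T` over the twelve monomials `T`. -/
def eval (v : TernaryCoeff V) (dia : A →ₗ[k] A →ₗ[k] A) (φ : A →ₗ[k] k) (a b c : A) : V :=
  φ (dia (dia a b) c) • v.ab_c + φ (dia (dia b a) c) • v.ba_c + φ (dia (dia b c) a) • v.bc_a +
  φ (dia (dia c b) a) • v.cb_a + φ (dia (dia a c) b) • v.ac_b + φ (dia (dia c a) b) • v.ca_b +
  φ (dia a (dia b c)) • v.a_bc + φ (dia b (dia a c)) • v.b_ac + φ (dia b (dia c a)) • v.b_ca +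
  φ (dia c (dia b a)) • v.c_ba + φ (dia a (dia c b)) • v.a_cb + φ (dia c (dia a b)) • v.c_ab

/-- The coefficients form a combination of the three pre-Lie identities. -/
structure IsPreLie (v : TernaryCoeff V) : Prop where
  ab_c_a_bc : v.ab_c + v.a_bc = 0
  ab_c_ba_c : v.ab_c + v.ba_c = 0
  ab_c_b_ac : v.ab_c - v.b_ac = 0
  bc_a_b_ca : v.bc_a + v.b_ca = 0
  bc_a_cb_a : v.bc_a + v.cb_a = 0
  bc_a_c_ba : v.bc_a - v.c_ba = 0
  ac_b_a_cb : v.ac_b + v.a_cb = 0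
  ac_b_ca_b : v.ac_b + v.ca_b = 0
  ac_b_c_ab : v.ac_b - v.c_ab = 0

/-- The combination vanishes on all homogeneous arguments. -/
def Vanishes (v : TernaryCoeff V) (𝒜 : ℤ → Submodule k A) (dia : A →ₗ[k] A →ₗ[k] A)
    (ω : LinearMap.BilinForm k A) : Prop :=
  ∀ d : A, ∀ i, ∀ a ∈ 𝒜 i, ∀ j, ∀ b ∈ 𝒜 j, ∀ l, ∀ c ∈ 𝒜 l, v.eval dia (ω d) a b c = 0

theorem IsPreLie.eval_eq_zero {v : TernaryCoeff V} (hv : v.IsPreLie)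
    {dia : A →ₗ[k] A →ₗ[k] A} (hdia : ∀ a b c : A,
      dia (dia a b) c - dia a (dia b c) = dia (dia b a) c - dia b (dia a c))
    (φ : A →ₗ[k] k) (a b c : A) : v.eval dia φ a b c = 0 := by
  have h (a b c : A) : φ (dia (dia a b) c) = φ (dia a (dia b c)) +
      φ (dia (dia b a) c) - φ (dia b (dia a c)) := by
    rw [← map_add, ← map_sub]
    exact congrArg φ (by linear_combination (norm := module) hdia a b c)
  -- Only `ab_c`, `bc_a` and `ac_b` remain as free coefficients, each multiplying one instance of
  -- the pre-Lie identity.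
  rw [eval, ← sub_eq_zero.mp hv.ab_c_b_ac, ← sub_eq_zero.mp hv.bc_a_c_ba,
    ← sub_eq_zero.mp hv.ac_b_c_ab, ← neg_eq_of_add_eq_zero_right hv.ab_c_a_bc,
    ← neg_eq_of_add_eq_zero_right hv.ab_c_ba_c, ← neg_eq_of_add_eq_zero_right hv.bc_a_b_ca,
    ← neg_eq_of_add_eq_zero_right hv.bc_a_cb_a, ← neg_eq_of_add_eq_zero_right hv.ac_b_a_cb,
    ← neg_eq_of_add_eq_zero_right hv.ac_b_ca_b, h a b c, h b c a, h a c b]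
  module

end TernaryCoeff

/-! ### Perm bialgebras in terms of ternary combinations -/

section PermCoeff

variable {k : Type*} [Field k] {P : Type*} [AddCommGroup P] [Module k P]

/-- The coefficients of the Jacobi identity for the induced bracket. -/
def jacobiCoeff (mul : P →ₗ[k] P →ₗ[k] P) (p q r : P) : TernaryCoeff P where
  ab_c := -mul (mul p q) r
  ba_c := mul (mul q p) r
  bc_a := -mul (mul q r) p
  cb_a := mul (mul r q) p
  ac_b := mul (mul p r) q
  ca_b := -mul (mul r p) q
  a_bc := mul p (mul q r)
  b_ac := -mul q (mul p r)
  b_ca := mul q (mul r p)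
  c_ba := -mul r (mul q p)
  a_cb := -mul p (mul r q)
  c_ab := mul r (mul p q)

/-- The coefficients of the co-Jacobi identity for the induced cobracket. -/
def coJacobiCoeff (Δ : P →ₗ[k] P ⊗[k] P) (p : P) : TernaryCoeff (P ⊗[k] (P ⊗[k] P)) :=
  let σ := (TensorProduct.comm k P P).toLinearMap
  let α := TensorProduct.assoc k P P P
  let τ := TensorProduct.leftComm k P P P
  { ab_c := -α (Δ.rTensor P (Δ p))
    ba_c := α ((σ ∘ₗ Δ).rTensor P (Δ p))
    bc_a := -Δ.lTensor P (σ (Δ p))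
    cb_a := (σ ∘ₗ Δ).lTensor P (σ (Δ p))
    ac_b := τ (Δ.lTensor P (σ (Δ p)))
    ca_b := -τ ((σ ∘ₗ Δ).lTensor P (σ (Δ p)))
    a_bc := Δ.lTensor P (Δ p)
    b_ac := -τ (Δ.lTensor P (Δ p))
    b_ca := τ ((σ ∘ₗ Δ).lTensor P (Δ p))
    c_ba := -α ((σ ∘ₗ Δ).rTensor P (σ (Δ p)))
    a_cb := -(σ ∘ₗ Δ).lTensor P (Δ p)
    c_ab := α (Δ.rTensor P (σ (Δ p))) }

/-- The coefficients of the compatibility of the induced bracket and cobracket. -/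
def compatCoeff (mul : P →ₗ[k] P →ₗ[k] P) (Δ : P →ₗ[k] P ⊗[k] P) (p q : P) :
    TernaryCoeff (P ⊗[k] P) :=
  let σ := TensorProduct.comm k P P
  { ab_c := -(mul p).rTensor P (Δ q) + (mul.flip q).lTensor P (σ (Δ p) - Δ p)
    ba_c := (mul p - mul.flip p).rTensor P (Δ q) + (mul.flip q).lTensor P (Δ p)
    bc_a := Δ (mul q p) - Δ (mul p q)
    cb_a := σ (Δ (mul p q) - Δ (mul q p))
    ac_b := (mul p).lTensor P (σ (Δ q)) + (mul.flip q).rTensor P (σ (Δ p) - Δ p)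
    ca_b := (mul.flip p - mul p).lTensor P (σ (Δ q)) - (mul.flip q).rTensor P (σ (Δ p))
    a_bc := Δ (mul p q)
    b_ac := -(mul p).lTensor P (Δ q) + (mul q - mul.flip q).rTensor P (σ (Δ p) - Δ p)
    b_ca := (mul p - mul.flip p).lTensor P (Δ q) - (mul q - mul.flip q).rTensor P (σ (Δ p))
    c_ba := (mul.flip p - mul p).rTensor P (σ (Δ q)) + (mul q - mul.flip q).lTensor P (Δ p)
    a_cb := -σ (Δ (mul p q))
    c_ab := (mul p).rTensor P (σ (Δ q)) + (mul q - mul.flip q).lTensor P (σ (Δ p) - Δ p) }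

/-- The two perm identities make the product of three elements depend only on which one comes last,
and this is what the nine equations express. The equations for `ab_c, a_bc` and `ab_c, ba_c` alone
give the axioms back. -/
theorem isPermAlgebra_iff {mul : P →ₗ[k] P →ₗ[k] P} :
    IsPermAlgebra mul ↔ ∀ p q r, (jacobiCoeff mul p q r).IsPreLie := by
  refine ⟨fun h p q r => ?_, fun h => ⟨fun p q r => ?_, fun p q r => ?_⟩⟩
  · constructor <;> simp only [jacobiCoeff]
    · rw [h.assoc]; abel
    · rw [h.left_comm]; abel
    · rw [h.assoc, h.left_comm]; abel
    · rw [h.assoc]; abel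
    · rw [h.left_comm]; abel
    · rw [h.assoc, h.left_comm]; abel
    · rw [h.assoc]; abel
    · rw [h.left_comm]; abel
    · rw [h.assoc, h.left_comm]; abel
  · have := (h p q r).ab_c_a_bc
    simp only [jacobiCoeff] at this
    rwa [neg_add_eq_zero, eq_comm] at this
  · have := (h p q r).ab_c_ba_c
    simp only [jacobiCoeff] at this
    rwa [neg_add_eq_zero] at this

theorem isPermCoalgebra_iff {Δ : P →ₗ[k] P ⊗[k] P} :
    IsPermCoalgebra Δ ↔ ∀ p, (coJacobiCoeff Δ p).IsPreLie := by
  refine ⟨fun h p => ?_, fun h => ⟨fun p => ?_, fun p => ?_⟩⟩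
  · have h₁ := h.coassoc p
    have h₂ := (h.left_cocomm p).symm
    set σ := (TensorProduct.comm k P P).toLinearMap with hσ
    have t₂ : Δ.lTensor P (σ (Δ p)) = TensorProduct.comm k (P ⊗[k] P) P (Δ.rTensor P (Δ p)) :=
      LinearMap.lTensor_comm _ _
    have v₂ : Δ.rTensor P (σ (Δ p)) = TensorProduct.comm k P (P ⊗[k] P) (Δ.lTensor P (Δ p)) :=
      LinearMap.rTensor_comm _ _
    set u := Δ.rTensor P (Δ p) with hu
    -- With `u = (Δ ⊗ id)Δ(p)`, symmetric in its first two slots, these permutation identities bring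
    -- all twelve coefficients, up to sign, to one of three tensors, according to the position of
    -- the last slot of `u`.
    have e₁ (u : (P ⊗[k] P) ⊗[k] P) : TensorProduct.leftComm k P P P
        (TensorProduct.assoc k P P P u) = TensorProduct.assoc k P P P (σ.rTensor P u) :=
      LinearMap.congr_fun (f := (TensorProduct.leftComm k P P P).toLinearMap ∘ₗ
        (TensorProduct.assoc k P P P).toLinearMap)
        (g := (TensorProduct.assoc k P P P).toLinearMap ∘ₗ σ.rTensor P) (by ext; rfl) u
    have e₂ (u : (P ⊗[k] P) ⊗[k] P) : TensorProduct.leftComm k P P P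
        (σ.lTensor P (TensorProduct.assoc k P P P u)) = TensorProduct.comm k (P ⊗[k] P) P u :=
      LinearMap.congr_fun (f := (TensorProduct.leftComm k P P P).toLinearMap ∘ₗ σ.lTensor P ∘ₗ
        (TensorProduct.assoc k P P P).toLinearMap)
        (g := (TensorProduct.comm k (P ⊗[k] P) P).toLinearMap) (by ext; rfl) u
    have e₃ (u : (P ⊗[k] P) ⊗[k] P) : σ.lTensor P (TensorProduct.comm k (P ⊗[k] P) P u) =
        TensorProduct.comm k (P ⊗[k] P) P (σ.rTensor P u) :=
      LinearMap.lTensor_comm σ u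
    have e₄ (u : (P ⊗[k] P) ⊗[k] P) : TensorProduct.assoc k P P P (σ.rTensor P
        (TensorProduct.comm k P (P ⊗[k] P) (TensorProduct.assoc k P P P u))) =
        TensorProduct.comm k (P ⊗[k] P) P (σ.rTensor P u) :=
      LinearMap.congr_fun (f := (TensorProduct.assoc k P P P).toLinearMap ∘ₗ σ.rTensor P ∘ₗ
        (TensorProduct.comm k P (P ⊗[k] P)).toLinearMap ∘ₗ
        (TensorProduct.assoc k P P P).toLinearMap)
        (g := (TensorProduct.comm k (P ⊗[k] P) P).toLinearMap ∘ₗ σ.rTensor P) (by ext; rfl) u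
    have e₅ (u : (P ⊗[k] P) ⊗[k] P) : TensorProduct.leftComm k P P P
        (TensorProduct.comm k (P ⊗[k] P) P u) =
        σ.lTensor P (TensorProduct.assoc k P P P u) :=
      LinearMap.congr_fun (f := (TensorProduct.leftComm k P P P).toLinearMap ∘ₗ
        (TensorProduct.comm k (P ⊗[k] P) P).toLinearMap)
        (g := σ.lTensor P ∘ₗ (TensorProduct.assoc k P P P).toLinearMap) (by ext; rfl) u
    have e₆ (u : (P ⊗[k] P) ⊗[k] P) : TensorProduct.assoc k P P P
        (TensorProduct.comm k P (P ⊗[k] P) (TensorProduct.assoc k P P P u)) =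
        σ.lTensor P (TensorProduct.assoc k P P P (σ.rTensor P u)) :=
      LinearMap.congr_fun (f := (TensorProduct.assoc k P P P).toLinearMap ∘ₗ
        (TensorProduct.comm k P (P ⊗[k] P)).toLinearMap ∘ₗ
        (TensorProduct.assoc k P P P).toLinearMap)
        (g := σ.lTensor P ∘ₗ (TensorProduct.assoc k P P P).toLinearMap ∘ₗ σ.rTensor P)
        (by ext; rfl) u
    constructor <;> simp only [coJacobiCoeff, LinearMap.rTensor_comp, LinearMap.lTensor_comp,
      LinearMap.comp_apply, ← hσ, ← hu, t₂, v₂, ← h₁, e₁, e₂, e₃, e₄, e₅, e₆, h₂] <;> abel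
  · have := (h p).ab_c_a_bc
    simp only [coJacobiCoeff] at this
    rwa [neg_add_eq_zero] at this
  · have := (h p).ab_c_ba_c
    simp only [coJacobiCoeff] at this
    rw [neg_add_eq_zero, EmbeddingLike.apply_eq_iff_eq, LinearMap.rTensor_comp] at this
    exact this

/-- The nine equations are linear combinations of the three axioms for `(p, q)`, for `(q, p)`, and
of their flips. Conversely the three equations involving `ab_c` at `(p, q)` recover the axioms. -/
theorem isPreLie_compatCoeff_iff {mul : P →ₗ[k] P →ₗ[k] P} {Δ : P →ₗ[k] P ⊗[k] P} :
    ((∀ p q : P, Δ (mul p q) =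
      (mul p - mul.flip p).rTensor P (Δ q) + (mul.flip q).lTensor P (Δ p)) ∧
    (∀ p q : P, TensorProduct.comm k P P ((mul.flip q).rTensor P (Δ p)) =
      (mul.flip p).rTensor P (Δ q)) ∧
    (∀ p q : P, Δ (mul p q) = (mul p).lTensor P (Δ q) +
      (mul q - mul.flip q).rTensor P (Δ p - TensorProduct.comm k P P (Δ p)))) ↔
    ∀ p q, (compatCoeff mul Δ p q).IsPreLie := by
  have hσ (f : P →ₗ[k] P) (x : P ⊗[k] P) := (LinearMap.lTensor_comm f x).symm
  have hσ' (f : P →ₗ[k] P) (x : P ⊗[k] P) := (LinearMap.rTensor_comm f x).symm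
  have hσσ (x : P ⊗[k] P) : TensorProduct.comm k P P (TensorProduct.comm k P P x) = x := by simp
  constructor
  · rintro ⟨h₁, h₂, h₃⟩ p q
    have c1 := h₁ p q
    have c2 := h₂ p q
    have c3 := h₃ p q
    have c1q := h₁ q p
    have c2q := h₂ q p
    have c3q := h₃ q p
    have s1 := congrArg (TensorProduct.comm k P P) c1
    have s3 := congrArg (TensorProduct.comm k P P) c3
    have s1q := congrArg (TensorProduct.comm k P P) c1q
    simp only [map_add, map_sub, LinearMap.rTensor_sub, LinearMap.sub_apply, hσ, hσ',
      hσσ] at c1 c2 c3 c1q c2q c3q s1 s3 s1q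
    constructor <;> simp only [compatCoeff, map_sub, LinearMap.rTensor_sub,
      LinearMap.lTensor_sub, LinearMap.sub_apply]
    · linear_combination (norm := module) c1 + c2
    · linear_combination (norm := module) c2
    · linear_combination (norm := module) c1 + c2 - c3
    · linear_combination (norm := module) c1q - c3
    · linear_combination (norm := module) -c1 + c3q + s3 - s1q
    · linear_combination (norm := module) -c1 + c3q
    · linear_combination (norm := module) c2q - s1
    · linear_combination (norm := module) c2q
    · linear_combination (norm := module) c2q - s1 + s3
  · intro h
    refine ⟨fun p q => ?_, fun p q => ?_, fun p q => ?_⟩ <;>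
    · have r0 := (h p q).ab_c_a_bc
      have r1 := (h p q).ab_c_ba_c
      have r2 := (h p q).ab_c_b_ac
      simp only [compatCoeff, map_sub, LinearMap.rTensor_sub, LinearMap.sub_apply,
        hσ] at r0 r1 r2 ⊢
      first
      | linear_combination (norm := module) r0 - r1
      | linear_combination (norm := module) r1
      | linear_combination (norm := module) r0 - r2

theorem isPermBialgebra_iff {mul : P →ₗ[k] P →ₗ[k] P} {Δ : P →ₗ[k] P ⊗[k] P} :
    IsPermBialgebra mul Δ ↔ (∀ p q r, (jacobiCoeff mul p q r).IsPreLie) ∧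
      (∀ p, (coJacobiCoeff Δ p).IsPreLie) ∧ ∀ p q, (compatCoeff mul Δ p q).IsPreLie := by
  rw [← isPermAlgebra_iff, ← isPermCoalgebra_iff, ← isPreLie_compatCoeff_iff]
  exact ⟨fun h => ⟨h.algebra, h.coalgebra, h.compat₁, h.compat₂, h.compat₃⟩,
    fun ⟨h₁, h₂, h₃, h₄, h₅⟩ => ⟨h₁, h₂, h₃, h₄, h₅⟩⟩

end PermCoeff

/-! ### The axioms of a completed Lie bialgebra as vanishing of ternary combinations -/

section Bialgebra

variable {k : Type*} [Field k] {A : Type*} [AddCommGroup A] [Module k A]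
  {𝒜 : ℤ → Submodule k A} [DirectSum.Decomposition 𝒜] {dia : A →ₗ[k] A →ₗ[k] A}
  {ω : LinearMap.BilinForm k A} {P : Type*} [AddCommGroup P] [Module k P]
  {mul : P →ₗ[k] P →ₗ[k] P} {ΔP : P →ₗ[k] P ⊗[k] P} {ΔA : A →ₗ[k] completedTensor 𝒜 𝒜}

omit [DirectSum.Decomposition 𝒜] in
-- Expanding the nested brackets of pure tensors yields each ternary monomial exactly once, with the
-- corresponding product in `P` as coefficient.
theorem contract_jacobi (p q r : P) (a b c d : A) :
    contract ω P d
      (inducedBracket mul dia (p ⊗ₜ a) (inducedBracket mul dia (q ⊗ₜ b) (r ⊗ₜ c)) +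
        inducedBracket mul dia (q ⊗ₜ b) (inducedBracket mul dia (r ⊗ₜ c) (p ⊗ₜ a)) +
        inducedBracket mul dia (r ⊗ₜ c) (inducedBracket mul dia (p ⊗ₜ a) (q ⊗ₜ b))) =
      (jacobiCoeff mul p q r).eval dia (ω.flip d) a b c := by
  simp only [inducedBracket_tmul, map_sub, map_add, contract_tmul, TernaryCoeff.eval, jacobiCoeff,
    LinearMap.BilinForm.flip_apply]
  module

theorem IsQuadraticGradedPreLie.isLieBracket (hA : IsQuadraticGradedPreLie 𝒜 dia ω)
    (h : ∀ p q r, (jacobiCoeff mul p q r).IsPreLie) :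
    IsLieBracket (inducedBracket mul dia) where
  self := inducedBracket_self mul
  jacobi x y z := by
    induction x with
    | zero => simp
    | add x x' hx hx' =>
      simp only [map_add, LinearMap.add_apply]
      linear_combination (norm := module) hx + hx'
    | tmul p a =>
      induction y with
      | zero => simp
      | add y y' hy hy' =>
        simp only [map_add, LinearMap.add_apply]
        linear_combination (norm := module) hy + hy'
      | tmul q b =>
        induction z with
        | zero => simp
        | add z z' hz hz' =>
          simp only [map_add, LinearMap.add_apply]
          linear_combination (norm := module) hz + hz'
        | tmul r c =>
          refine hA.eq_zero_of_contract (fun d => ?_)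
          rw [contract_jacobi]
          exact (h p q r).eval_eq_zero hA.preLie _ a b c

theorem IsQuadraticGradedPreLie.vanishes_jacobiCoeff (hA : IsQuadraticGradedPreLie 𝒜 dia ω)
    (h : IsLieBracket (inducedBracket mul dia)) (p q r : P) :
    (jacobiCoeff mul p q r).Vanishes 𝒜 dia ω := by
  intro d i a _ j b _ l c _
  -- Contraction puts `d` in the second argument of `ω`, while `Vanishes` has it in the first;
  -- skew-symmetry costs only a sign.
  have hd : ω d = -ω.flip d := LinearMap.ext fun x => hA.skew d x
  have := contract_jacobi (ω := ω) (mul := mul) (dia := dia) p q r a b c d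
  rw [h.jacobi, map_zero] at this
  rw [hd, ← neg_zero, this]
  simp only [TernaryCoeff.eval, LinearMap.neg_apply]
  module

/-! #### The co-Jacobi identity -/

variable (ΔP ΔA) in
/-- The induced cobracket as a map into the product of all entries. -/
abbrev cobracketEntries : P ⊗[k] A →ₗ[k] (ℤ × ℤ → (P ⊗[k] A) ⊗[k] (P ⊗[k] A)) :=
  (completedTensor (tensorGrading P 𝒜) (tensorGrading P 𝒜)).subtype ∘ₗ inducedCobracket ΔP ΔA

theorem IsQuadraticGradedPreLie.vanishesCofinitely_cobracketEntries
    (hA : IsQuadraticGradedPreLie 𝒜 dia ω) (hΔ : IsInducedCoproduct 𝒜 dia ω ΔA) (ij : ℤ × ℤ) :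
    VanishesCofinitely (tensorGrading P 𝒜) (LinearMap.proj ij ∘ₗ cobracketEntries ΔP ΔA) :=
  hA.inducedCobracket_columnFinite hΔ ij

theorem map_contract_comp_cobracketEntries {m : ℤ}
    (hm : ∀ i j : ℤ, i + j ≠ m → ∀ a ∈ 𝒜 i, ∀ b ∈ 𝒜 j, ω a b = 0)
    (hΔ : IsInducedCoproduct 𝒜 dia ω ΔA) {i j : ℤ} {c d : A}
    (hc : c ∈ 𝒜 (m - i)) (hd : d ∈ 𝒜 (m - j)) :
    TensorProduct.map (contract ω P c) (contract ω P d) ∘ₗ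
        LinearMap.proj (i, j) ∘ₗ cobracketEntries ΔP ΔA =
      ((TensorProduct.comm k P P).toLinearMap ∘ₗ ΔP) ∘ₗ contract ω P (dia d c) +
        (-ΔP) ∘ₗ contract ω P (dia c d) :=
  LinearMap.ext fun z => (map_contract_inducedCobracket hm hΔ hc hd z).trans (sub_eq_add_neg _ _)

theorem contract_comp_homogeneousProj {m : ℤ}
    (hm : ∀ i j : ℤ, i + j ≠ m → ∀ a ∈ 𝒜 i, ∀ b ∈ 𝒜 j, ω a b = 0) {i : ℤ} {b : A}
    (hb : b ∈ 𝒜 (m - i)) :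
    contract ω P b ∘ₗ homogeneousProj (tensorGrading P 𝒜) i = contract ω P b :=
  comp_homogeneousProj (contract_eq_zero hm hb)

/-- The contracted cobracket formula is used twice: on the inner cobracket, which turns `c` and `d`
into products, and then on the outer one paired with `b` and those products. -/
theorem map_contract_cobracket_right (hA : IsQuadraticGradedPreLie 𝒜 dia ω) {m : ℤ}
    (hm : ∀ i j : ℤ, i + j ≠ m → ∀ a ∈ 𝒜 i, ∀ b ∈ 𝒜 j, ω a b = 0)
    (hΔ : IsInducedCoproduct 𝒜 dia ω ΔA) {i j l : ℤ} {b c d : A} (hb : b ∈ 𝒜 (m - i))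
    (hc : c ∈ 𝒜 (m - j)) (hd : d ∈ 𝒜 (m - l)) (z : P ⊗[k] A) :
    TensorProduct.map (contract ω P b) (TensorProduct.map (contract ω P c) (contract ω P d))
        (completedMap (components (tensorGrading P 𝒜)) (cobracketEntries ΔP ΔA)
          (inducedCobracket ΔP ΔA z).1 (i, j, l)) =
      ((TensorProduct.comm k P P).toLinearMap ∘ₗ ΔP).lTensor P
          (TensorProduct.comm k P P (ΔP (contract ω P (dia (dia d c) b) z)) -
            ΔP (contract ω P (dia b (dia d c)) z)) -
        ΔP.lTensor P
          (TensorProduct.comm k P P (ΔP (contract ω P (dia (dia c d) b) z)) -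
            ΔP (contract ω P (dia b (dia c d)) z)) := by
  have hf := vanishesCofinitely_contract (P := P) hA.graded
  have hz := (inducedCobracket ΔP ΔA z).2
  rw [completedMap_apply]
  refine (map_evalTensor hz (vanishesCofinitely_homogeneousProj i)
    (hA.vanishesCofinitely_cobracketEntries hΔ (j, l)) _ _).trans ?_
  rw [map_contract_comp_cobracketEntries hm hΔ hc hd,
    evalTensor_add_right hz ((vanishesCofinitely_homogeneousProj i).comp _) ((hf _).comp _)
      ((hf _).comp _)]
  change evalTensor (contract ω P b ∘ₗ homogeneousProj _ i) _ _ +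
    evalTensor (contract ω P b ∘ₗ homogeneousProj _ i) _ _ = _
  rw [contract_comp_homogeneousProj hm hb, evalTensor_comp_right hz (hf _) (hf _),
    evalTensor_comp_right hz (hf _) (hf _),
    evalTensor_contract_inducedCobracket hA.graded hΔ,
    evalTensor_contract_inducedCobracket hA.graded hΔ, LinearMap.lTensor_neg, LinearMap.neg_apply,
    ← sub_eq_add_neg]

theorem map_contract_cobracket_left (hA : IsQuadraticGradedPreLie 𝒜 dia ω) {m : ℤ}
    (hm : ∀ i j : ℤ, i + j ≠ m → ∀ a ∈ 𝒜 i, ∀ b ∈ 𝒜 j, ω a b = 0)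
    (hΔ : IsInducedCoproduct 𝒜 dia ω ΔA) {i j l : ℤ} {b c d : A} (hb : b ∈ 𝒜 (m - i))
    (hc : c ∈ 𝒜 (m - j)) (hd : d ∈ 𝒜 (m - l)) (z : P ⊗[k] A) :
    TensorProduct.map (TensorProduct.map (contract ω P b) (contract ω P c)) (contract ω P d)
        (completedMap (cobracketEntries ΔP ΔA) (components (tensorGrading P 𝒜))
          (inducedCobracket ΔP ΔA z).1 ((i, j), l)) =
      ((TensorProduct.comm k P P).toLinearMap ∘ₗ ΔP).rTensor P
          (TensorProduct.comm k P P (ΔP (contract ω P (dia d (dia c b)) z)) -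
            ΔP (contract ω P (dia (dia c b) d) z)) -
        ΔP.rTensor P
          (TensorProduct.comm k P P (ΔP (contract ω P (dia d (dia b c)) z)) -
            ΔP (contract ω P (dia (dia b c) d) z)) := by
  have hf := vanishesCofinitely_contract (P := P) hA.graded
  have hz := (inducedCobracket ΔP ΔA z).2
  rw [completedMap_apply]
  refine (map_evalTensor hz (hA.vanishesCofinitely_cobracketEntries hΔ (i, j))
    (vanishesCofinitely_homogeneousProj l) _ _).trans ?_
  rw [map_contract_comp_cobracketEntries hm hΔ hb hc,
    evalTensor_add_left hz ((hf _).comp _) ((hf _).comp _)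
      ((vanishesCofinitely_homogeneousProj l).comp _)]
  change evalTensor _ (contract ω P d ∘ₗ homogeneousProj _ l) _ +
    evalTensor _ (contract ω P d ∘ₗ homogeneousProj _ l) _ = _
  rw [contract_comp_homogeneousProj hm hd, evalTensor_comp_left hz (hf _) (hf _),
    evalTensor_comp_left hz (hf _) (hf _),
    evalTensor_contract_inducedCobracket hA.graded hΔ,
    evalTensor_contract_inducedCobracket hA.graded hΔ, LinearMap.rTensor_neg, LinearMap.neg_apply,
    ← sub_eq_add_neg]

variable (ΔP ΔA) in
/-- The left-hand side of the co-Jacobi identity. -/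
def coJacobiator (z : P ⊗[k] A) :
    ℤ × ℤ × ℤ → (P ⊗[k] A) ⊗[k] ((P ⊗[k] A) ⊗[k] (P ⊗[k] A)) :=
  completedMap (components (tensorGrading P 𝒜)) (cobracketEntries ΔP ΔA)
      (inducedCobracket ΔP ΔA z).1 -
    flipFirstTwo (completedMap (components (tensorGrading P 𝒜)) (cobracketEntries ΔP ΔA)
      (inducedCobracket ΔP ΔA z).1) -
    reassoc (completedMap (cobracketEntries ΔP ΔA) (components (tensorGrading P 𝒜))
      (inducedCobracket ΔP ΔA z).1)

/-! ### Naturality of the threefold tensor permutations -/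

section Naturality

variable {L M : Type*} [AddCommGroup L] [Module k L] [AddCommGroup M] [Module k M]

theorem map_leftComm (f g h : L →ₗ[k] M) (x : L ⊗[k] (L ⊗[k] L)) :
    TensorProduct.map f (TensorProduct.map g h) (TensorProduct.leftComm k L L L x) =
      TensorProduct.leftComm k M M M (TensorProduct.map g (TensorProduct.map f h) x) :=
  LinearMap.congr_fun (f := TensorProduct.map f (TensorProduct.map g h) ∘ₗ
      (TensorProduct.leftComm k L L L).toLinearMap)
    (g := (TensorProduct.leftComm k M M M).toLinearMap ∘ₗ
      TensorProduct.map g (TensorProduct.map f h)) (by ext; rfl) x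

theorem map_assoc (f g h : L →ₗ[k] M) (x : (L ⊗[k] L) ⊗[k] L) :
    TensorProduct.map f (TensorProduct.map g h) (TensorProduct.assoc k L L L x) =
      TensorProduct.assoc k M M M (TensorProduct.map (TensorProduct.map f g) h x) :=
  LinearMap.congr_fun (f := TensorProduct.map f (TensorProduct.map g h) ∘ₗ
      (TensorProduct.assoc k L L L).toLinearMap)
    (g := (TensorProduct.assoc k M M M).toLinearMap ∘ₗ
      TensorProduct.map (TensorProduct.map f g) h) (by ext; rfl) x

end Naturality

theorem coJacobiator_apply (z : P ⊗[k] A) (i j l : ℤ) :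
    coJacobiator ΔP ΔA z (i, j, l) =
      completedMap (components (tensorGrading P 𝒜)) (cobracketEntries ΔP ΔA)
        (inducedCobracket ΔP ΔA z).1 (i, j, l) -
      TensorProduct.leftComm k _ _ _
        (completedMap (components (tensorGrading P 𝒜)) (cobracketEntries ΔP ΔA)
          (inducedCobracket ΔP ΔA z).1 (j, i, l)) -
      TensorProduct.assoc k _ _ _
        (completedMap (cobracketEntries ΔP ΔA) (components (tensorGrading P 𝒜))
          (inducedCobracket ΔP ΔA z).1 ((i, j), l)) := rfl

/-- Contracting the co-Jacobi identity gives a linear map that evaluates the co-Jacobi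
coefficients on pure tensors. -/
theorem exists_contract_coJacobiator (hA : IsQuadraticGradedPreLie 𝒜 dia ω) {m : ℤ}
    (hm : ∀ i j : ℤ, i + j ≠ m → ∀ a ∈ 𝒜 i, ∀ b ∈ 𝒜 j, ω a b = 0)
    (hΔ : IsInducedCoproduct 𝒜 dia ω ΔA) {i j l : ℤ} {b c d : A} (hb : b ∈ 𝒜 (m - i))
    (hc : c ∈ 𝒜 (m - j)) (hd : d ∈ 𝒜 (m - l)) :
    ∃ F : P ⊗[k] A →ₗ[k] P ⊗[k] (P ⊗[k] P),
      (∀ z, TensorProduct.map (contract ω P b)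
        (TensorProduct.map (contract ω P c) (contract ω P d))
          (coJacobiator ΔP ΔA z (i, j, l)) = F z) ∧
      ∀ p a, F (p ⊗ₜ a) = (coJacobiCoeff ΔP p).eval dia (ω a) b c d := by
  let σ := (TensorProduct.comm k P P).toLinearMap
  -- `X` and `Y` are the contractions of `(id ⊗̂ δ)δ` and `(δ ⊗̂ id)δ`, written as linear maps in
  -- `z`. This linearity is not visible through the `finsum` and is what allows reduction to pure
  -- tensors.
  let X (b c d : A) : P ⊗[k] A →ₗ[k] P ⊗[k] (P ⊗[k] P) :=
    (σ ∘ₗ ΔP).lTensor P ∘ₗ (σ ∘ₗ ΔP ∘ₗ contract ω P (dia (dia d c) b) -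
        ΔP ∘ₗ contract ω P (dia b (dia d c))) -
      ΔP.lTensor P ∘ₗ (σ ∘ₗ ΔP ∘ₗ contract ω P (dia (dia c d) b) -
        ΔP ∘ₗ contract ω P (dia b (dia c d)))
  let Y : P ⊗[k] A →ₗ[k] (P ⊗[k] P) ⊗[k] P :=
    (σ ∘ₗ ΔP).rTensor P ∘ₗ (σ ∘ₗ ΔP ∘ₗ contract ω P (dia d (dia c b)) -
        ΔP ∘ₗ contract ω P (dia (dia c b) d)) -
      ΔP.rTensor P ∘ₗ (σ ∘ₗ ΔP ∘ₗ contract ω P (dia d (dia b c)) -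
        ΔP ∘ₗ contract ω P (dia (dia b c) d))
  refine ⟨X b c d - (TensorProduct.leftComm k P P P).toLinearMap ∘ₗ X c b d -
    (TensorProduct.assoc k P P P).toLinearMap ∘ₗ Y, fun z => ?_, fun p a => ?_⟩
  · rw [coJacobiator_apply, map_sub, map_sub, map_leftComm, map_assoc,
      map_contract_cobracket_right hA hm hΔ hb hc hd,
      map_contract_cobracket_right hA hm hΔ hc hb hd,
      map_contract_cobracket_left hA hm hΔ hb hc hd]
    rfl
  · simp only [X, Y, LinearMap.sub_apply, LinearMap.comp_apply, contract_tmul, map_smul, map_sub,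
      LinearEquiv.coe_coe, TernaryCoeff.eval, coJacobiCoeff, σ]
    module

/-- Used with homogeneous projections for `φ` and `ψ`: it shows that the entries of the iterated
cobrackets are homogeneous, as the separation criterion requires. -/
theorem map_comp_completedMap_apply {C D M N ι κ : Type*} [AddCommGroup C] [Module k C]
    [AddCommGroup D] [Module k D] [AddCommGroup M] [Module k M] [AddCommGroup N] [Module k N]
    {𝒞 : ℤ → Submodule k C} {𝒟 : ℤ → Submodule k D} {f : C →ₗ[k] (ι → M)} {g : D →ₗ[k] (κ → N)}
    {x : ℤ × ℤ → C ⊗[k] D} (hx : x ∈ completedTensor 𝒞 𝒟) {s : ι × κ}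
    (hf : VanishesCofinitely 𝒞 (LinearMap.proj s.1 ∘ₗ f))
    (hg : VanishesCofinitely 𝒟 (LinearMap.proj s.2 ∘ₗ g)) {φ : M →ₗ[k] M} {ψ : N →ₗ[k] N}
    (hφ : φ ∘ₗ LinearMap.proj s.1 ∘ₗ f = LinearMap.proj s.1 ∘ₗ f)
    (hψ : ψ ∘ₗ LinearMap.proj s.2 ∘ₗ g = LinearMap.proj s.2 ∘ₗ g) :
    TensorProduct.map φ ψ (completedMap f g x s) = completedMap f g x s := by
  rw [completedMap_apply, map_evalTensor hx hf hg, hφ, hψ]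

theorem IsQuadraticGradedPreLie.coJacobiator_eq_zero (hA : IsQuadraticGradedPreLie 𝒜 dia ω)
    (hΔ : IsInducedCoproduct 𝒜 dia ω ΔA) (h : ∀ p, (coJacobiCoeff ΔP p).IsPreLie)
    (z : P ⊗[k] A) : coJacobiator ΔP ΔA z = 0 := by
  obtain ⟨m, hm⟩ := hA.graded
  have hcol := hA.vanishesCofinitely_cobracketEntries (P := P) (ΔP := ΔP) hΔ
  have hpr (i j : ℤ) : TensorProduct.map (homogeneousProj (tensorGrading P 𝒜) i)
      (homogeneousProj (tensorGrading P 𝒜) j) ∘ₗ LinearMap.proj (i, j) ∘ₗ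
        cobracketEntries ΔP ΔA = LinearMap.proj (i, j) ∘ₗ cobracketEntries ΔP ΔA :=
    LinearMap.ext fun z => map_homogeneousProj_of_mem
      (entry_mem (inducedCobracket ΔP ΔA z).2 (i, j))
  have hX (i j l : ℤ) := map_comp_completedMap_apply (inducedCobracket ΔP ΔA z).2
    (s := (i, j, l)) (f := components (tensorGrading P 𝒜)) (vanishesCofinitely_homogeneousProj i)
    (hcol (j, l)) (homogeneousProj_comp_self i) (hpr j l)
  have hY (i j l : ℤ) := map_comp_completedMap_apply (inducedCobracket ΔP ΔA z).2
    (s := ((i, j), l)) (g := components (tensorGrading P 𝒜)) (hcol (i, j))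
    (vanishesCofinitely_homogeneousProj l) (hpr i j) (homogeneousProj_comp_self l)
  funext ⟨i, j, l⟩
  refine hA.eq_of_contract₃ hm (i := i) (j := j) (l := l) ?_ (by simp) fun b hb c hc d hd => ?_
  · rw [coJacobiator_apply, map_sub, map_sub, map_leftComm, map_assoc, hX, hX, hY]
  · obtain ⟨F, hF, hF'⟩ := exists_contract_coJacobiator (ΔP := ΔP) hA hm hΔ hb hc hd
    rw [hF]
    have : F = 0 := TensorProduct.ext' fun p a => by
      rw [hF', (h p).eval_eq_zero hA.preLie, LinearMap.zero_apply]
    simp [this]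

theorem IsQuadraticGradedPreLie.vanishes_coJacobiCoeff (hA : IsQuadraticGradedPreLie 𝒜 dia ω)
    (hΔ : IsInducedCoproduct 𝒜 dia ω ΔA) (h : ∀ z, coJacobiator ΔP ΔA z = 0) (p : P) :
    (coJacobiCoeff ΔP p).Vanishes 𝒜 dia ω := by
  obtain ⟨m, hm⟩ := hA.graded
  intro a i b hb j c hc l d hd
  obtain ⟨F, hF, hF'⟩ := exists_contract_coJacobiator (ΔP := ΔP) hA hm hΔ
    (i := m - i) (j := m - j) (l := m - l) (by rwa [sub_sub_cancel]) (by rwa [sub_sub_cancel])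
    (by rwa [sub_sub_cancel])
  rw [← hF', ← hF, h]
  simp

end Bialgebra

/-! ### The adjoint action on completed tensors -/

section AdAction

variable {k : Type*} [Field k] {C M N : Type*} [AddCommGroup C] [Module k C]
  [AddCommGroup M] [Module k M] [AddCommGroup N] [Module k N]
  {𝒞 : ℤ → Submodule k C} [DirectSum.Decomposition 𝒞]

theorem map_completedMap_comp_components {B B' : C →ₗ[k] C} {i j : ℤ}
    (hB : VanishesCofinitely 𝒞 (homogeneousProj 𝒞 i ∘ₗ B))
    (hB' : VanishesCofinitely 𝒞 (homogeneousProj 𝒞 j ∘ₗ B')) {f : C →ₗ[k] M} {g : C →ₗ[k] N}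
    (hf : f ∘ₗ homogeneousProj 𝒞 i = f) (hg : g ∘ₗ homogeneousProj 𝒞 j = g)
    {y : ℤ × ℤ → C ⊗[k] C} (hy : y ∈ completedTensor 𝒞 𝒞) :
    TensorProduct.map f g (completedMap (components 𝒞 ∘ₗ B) (components 𝒞 ∘ₗ B') y (i, j)) =
      evalTensor (f ∘ₗ B) (g ∘ₗ B') y := by
  have := map_evalTensor hy hB hB' f g
  rw [← LinearMap.comp_assoc, ← LinearMap.comp_assoc, hf, hg] at this
  exact this

theorem map_adAction {br : C →ₗ[k] C →ₗ[k] C} {a : C}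
    (had : IsColumnFinite 𝒞 (components 𝒞 ∘ₗ br a)) {i j : ℤ} {f : C →ₗ[k] M} {g : C →ₗ[k] N}
    (hf : f ∘ₗ homogeneousProj 𝒞 i = f) (hg : g ∘ₗ homogeneousProj 𝒞 j = g)
    {y : ℤ × ℤ → C ⊗[k] C} (hy : y ∈ completedTensor 𝒞 𝒞) :
    TensorProduct.map f g (adAction 𝒞 br a y (i, j)) =
      evalTensor (f ∘ₗ br a) g y + evalTensor f (g ∘ₗ br a) y := by
  have hi : VanishesCofinitely 𝒞 (homogeneousProj 𝒞 i ∘ₗ br a) := had i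
  have hj : VanishesCofinitely 𝒞 (homogeneousProj 𝒞 j ∘ₗ br a) := had j
  rw [adAction, Pi.add_apply, map_add]
  -- A bare `components` is its composite with the identity, so both summands are instances of one
  -- lemma.
  exact congrArg₂ (· + ·)
    (map_completedMap_comp_components (B' := LinearMap.id) hi
      (vanishesCofinitely_homogeneousProj j) hf hg hy)
    (map_completedMap_comp_components (B := LinearMap.id)
      (vanishesCofinitely_homogeneousProj i) hj hf hg hy)

theorem map_homogeneousProj_adAction {br : C →ₗ[k] C →ₗ[k] C} {a : C}
    (had : IsColumnFinite 𝒞 (components 𝒞 ∘ₗ br a)) (i j : ℤ)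
    {y : ℤ × ℤ → C ⊗[k] C} (hy : y ∈ completedTensor 𝒞 𝒞) :
    TensorProduct.map (homogeneousProj 𝒞 i) (homogeneousProj 𝒞 j) (adAction 𝒞 br a y (i, j)) =
      adAction 𝒞 br a y (i, j) := by
  rw [map_adAction had (homogeneousProj_comp_self i) (homogeneousProj_comp_self j) hy]
  rfl

end AdAction

/-! ### Compatibility of bracket and cobracket, and the resulting bialgebra statements -/

section Compat

variable {k : Type*} [Field k] {A : Type*} [AddCommGroup A] [Module k A]
  {𝒜 : ℤ → Submodule k A} [DirectSum.Decomposition 𝒜] {dia : A →ₗ[k] A →ₗ[k] A}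
  {ω : LinearMap.BilinForm k A} {P : Type*} [AddCommGroup P] [Module k P]
  {mul : P →ₗ[k] P →ₗ[k] P} {ΔP : P →ₗ[k] P ⊗[k] P} {ΔA : A →ₗ[k] completedTensor 𝒜 𝒜}

theorem VanishesCofinitely.contract_comp_inducedBracket
    (hA : IsQuadraticGradedPreLie 𝒜 dia ω) (x : P ⊗[k] A) (c : A) :
    VanishesCofinitely (tensorGrading P 𝒜) (contract ω P c ∘ₗ inducedBracket mul dia x) := by
  have hf := vanishesCofinitely_contract (P := P) hA.graded
  induction x with
  | zero => exact .of_forall ∅ (by simp)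
  | add x y hx hy => rw [map_add, LinearMap.comp_add]; exact hx.add hy
  | tmul p a =>
    rw [hA.contract_comp_inducedBracket]
    exact ((hf _).comp _).add ((hf _).comp _)

variable (dia ω mul ΔP ΔA) in
/-- The contraction with `c` and `d` of the operator `ad(x) ⊗̂ id + id ⊗̂ ad(x)` applied to the
cobracket of `y`. -/
def contractedAction (c d : A) (x y : P ⊗[k] A) : P ⊗[k] P :=
  evalTensor (contract ω P c ∘ₗ inducedBracket mul dia x) (contract ω P d)
      (inducedCobracket ΔP ΔA y).1 +
    evalTensor (contract ω P c) (contract ω P d ∘ₗ inducedBracket mul dia x)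
      (inducedCobracket ΔP ΔA y).1

theorem contractedAction_add_left (hA : IsQuadraticGradedPreLie 𝒜 dia ω) (c d : A)
    (x x' y : P ⊗[k] A) : contractedAction dia ω mul ΔP ΔA c d (x + x') y =
      contractedAction dia ω mul ΔP ΔA c d x y + contractedAction dia ω mul ΔP ΔA c d x' y := by
  have hf := vanishesCofinitely_contract (P := P) hA.graded
  have hg := VanishesCofinitely.contract_comp_inducedBracket (mul := mul) hA
  simp only [contractedAction, map_add, LinearMap.comp_add]
  rw [evalTensor_add_left (Subtype.prop _) (hg _ _) (hg _ _) (hf _),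
    evalTensor_add_right (Subtype.prop _) (hf _) (hg _ _) (hg _ _)]
  abel

theorem contractedAction_add_right (hA : IsQuadraticGradedPreLie 𝒜 dia ω) (c d : A)
    (x y y' : P ⊗[k] A) : contractedAction dia ω mul ΔP ΔA c d x (y + y') =
      contractedAction dia ω mul ΔP ΔA c d x y + contractedAction dia ω mul ΔP ΔA c d x y' := by
  have hf := vanishesCofinitely_contract (P := P) hA.graded
  have hg := VanishesCofinitely.contract_comp_inducedBracket (mul := mul) hA
  simp only [contractedAction, map_add, Submodule.coe_add]
  rw [evalTensor_add (Subtype.prop _) (Subtype.prop _) (hg _ _) (hf _),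
    evalTensor_add (Subtype.prop _) (Subtype.prop _) (hf _) (hg _ _)]
  abel

omit [DirectSum.Decomposition 𝒜] in
theorem contractedAction_zero_left (c d : A) (y : P ⊗[k] A) :
    contractedAction dia ω mul ΔP ΔA c d 0 y = 0 := by
  simp [contractedAction, evalTensor]

omit [DirectSum.Decomposition 𝒜] in
theorem contractedAction_zero_right (c d : A) (x : P ⊗[k] A) :
    contractedAction dia ω mul ΔP ΔA c d x 0 = 0 := by
  simp [contractedAction, evalTensor]

theorem contractedAction_tmul (hA : IsQuadraticGradedPreLie 𝒜 dia ω)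
    (hΔ : IsInducedCoproduct 𝒜 dia ω ΔA) (c d : A) (p q : P) (a b : A) :
    contractedAction dia ω mul ΔP ΔA c d (p ⊗ₜ a) (q ⊗ₜ b) =
      (-mul p).rTensor P (ω b (dia d (dia a c)) • TensorProduct.comm k P P (ΔP q) -
        ω b (dia (dia a c) d) • ΔP q) +
      (mul p - mul.flip p).rTensor P (ω b (dia d (dia c a)) • TensorProduct.comm k P P (ΔP q) -
        ω b (dia (dia c a) d) • ΔP q) +
      ((-mul p).lTensor P (ω b (dia (dia a d) c) • TensorProduct.comm k P P (ΔP q) -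
        ω b (dia c (dia a d)) • ΔP q) +
      (mul p - mul.flip p).lTensor P (ω b (dia (dia d a) c) • TensorProduct.comm k P P (ΔP q) -
        ω b (dia c (dia d a)) • ΔP q)) := by
  have hf := vanishesCofinitely_contract (P := P) hA.graded
  have hz := (inducedCobracket ΔP ΔA (q ⊗ₜ[k] b)).2
  have key (c d : A) : evalTensor (contract ω P c) (contract ω P d)
      (inducedCobracket ΔP ΔA (q ⊗ₜ b)).1 =
      ω b (dia d c) • TensorProduct.comm k P P (ΔP q) - ω b (dia c d) • ΔP q := by
    rw [evalTensor_contract_inducedCobracket hA.graded hΔ]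
    simp only [contract_tmul, map_smul]
  rw [contractedAction, hA.contract_comp_inducedBracket, hA.contract_comp_inducedBracket,
    evalTensor_add_left hz ((hf _).comp _) ((hf _).comp _) (hf _),
    evalTensor_add_right hz (hf _) ((hf _).comp _) ((hf _).comp _),
    evalTensor_comp_left hz (hf _) (hf _), evalTensor_comp_left hz (hf _) (hf _),
    evalTensor_comp_right hz (hf _) (hf _), evalTensor_comp_right hz (hf _) (hf _),
    key, key, key, key]

/-- After both sides are contracted, invariance of `ω` writes every term as `ω(b, T(a, c, d))` for a
ternary monomial `T`; collecting coefficients gives `compatCoeff`. -/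
theorem contract_compat_tmul (hA : IsQuadraticGradedPreLie 𝒜 dia ω)
    (hΔ : IsInducedCoproduct 𝒜 dia ω ΔA) (c d : A) (p q : P) (a b : A) :
    evalTensor (contract ω P c) (contract ω P d)
        (inducedCobracket ΔP ΔA (inducedBracket mul dia (p ⊗ₜ a) (q ⊗ₜ b))).1 -
      (contractedAction dia ω mul ΔP ΔA c d (p ⊗ₜ a) (q ⊗ₜ b) -
        contractedAction dia ω mul ΔP ΔA c d (q ⊗ₜ b) (p ⊗ₜ a)) =
      (compatCoeff mul ΔP p q).eval dia (ω b) a c d := by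
  have e (c : A) : contract ω P c (inducedBracket mul dia (p ⊗ₜ a) (q ⊗ₜ b)) =
      -(ω b (dia a c) • mul p q) + ω b (dia c a) • (mul p q - mul q p) := by
    refine (LinearMap.congr_fun (hA.contract_comp_inducedBracket mul p a c) (q ⊗ₜ b)).trans ?_
    simp
  -- The terms from `ad(q ⊗ b)` have `a` outside and `b` inside the monomial. These four identities
  -- exchange the two roles.
  have w₁ (c d : A) : ω a (dia (dia b c) d) = -ω b (dia (dia a d) c) := by
    rw [← hA.form_left_swap, hA.skew, hA.form_left_swap]
  have w₂ (c d : A) : ω a (dia d (dia b c)) = -ω b (dia (dia a d) c) + ω b (dia (dia d a) c) := by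
    rw [← hA.form_left_swap, hA.invariant, hA.form_left_swap]
    simp; ring
  have w₃ (c d : A) : ω a (dia (dia c b) d) = ω b (dia c (dia a d)) - ω b (dia (dia a d) c) := by
    rw [← hA.form_left_swap, hA.skew, hA.invariant]
    simp
  have w₄ (c d : A) : ω a (dia d (dia c b)) = ω b (dia c (dia a d)) - ω b (dia c (dia d a)) -
      ω b (dia (dia a d) c) + ω b (dia (dia d a) c) := by
    rw [← hA.form_left_swap, hA.invariant, hA.invariant]
    simp; ring
  rw [evalTensor_contract_inducedCobracket hA.graded hΔ, contractedAction_tmul hA hΔ,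
    contractedAction_tmul hA hΔ, e, e]
  simp only [w₁, w₂, w₃, w₄, TernaryCoeff.eval, compatCoeff, map_add, map_sub, map_neg, map_smul,
    LinearMap.rTensor_sub, LinearMap.lTensor_sub, LinearMap.rTensor_neg, LinearMap.lTensor_neg,
    LinearMap.sub_apply, LinearMap.neg_apply]
  module

theorem map_contract_adAction (hA : IsQuadraticGradedPreLie 𝒜 dia ω) {m : ℤ}
    (hm : ∀ i j : ℤ, i + j ≠ m → ∀ a ∈ 𝒜 i, ∀ b ∈ 𝒜 j, ω a b = 0) {i j : ℤ} {c d : A}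
    (hc : c ∈ 𝒜 (m - i)) (hd : d ∈ 𝒜 (m - j)) (x y : P ⊗[k] A) :
    TensorProduct.map (contract ω P c) (contract ω P d)
        (adAction (tensorGrading P 𝒜) (inducedBracket mul dia) x
          (inducedCobracket ΔP ΔA y).1 (i, j)) =
      contractedAction dia ω mul ΔP ΔA c d x y :=
  map_adAction (inducedBracket_ad_columnFinite hA.toIsGradedPreLie mul x)
    (contract_comp_homogeneousProj hm hc) (contract_comp_homogeneousProj hm hd)
    (inducedCobracket ΔP ΔA y).2

theorem IsQuadraticGradedPreLie.compat (hA : IsQuadraticGradedPreLie 𝒜 dia ω)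
    (hΔ : IsInducedCoproduct 𝒜 dia ω ΔA) (h : ∀ p q, (compatCoeff mul ΔP p q).IsPreLie)
    (x y : P ⊗[k] A) :
    (inducedCobracket ΔP ΔA (inducedBracket mul dia x y)).1 =
      adAction (tensorGrading P 𝒜) (inducedBracket mul dia) x (inducedCobracket ΔP ΔA y).1 -
        adAction (tensorGrading P 𝒜) (inducedBracket mul dia) y
          (inducedCobracket ΔP ΔA x).1 := by
  obtain ⟨m, hm⟩ := hA.graded
  have hf := vanishesCofinitely_contract (P := P) hA.graded
  -- Both sides are biadditive in `x` and `y` once contracted, so pure tensors suffice.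
  have key (c d : A) : evalTensor (contract ω P c) (contract ω P d)
        (inducedCobracket ΔP ΔA (inducedBracket mul dia x y)).1 =
      contractedAction dia ω mul ΔP ΔA c d x y - contractedAction dia ω mul ΔP ΔA c d y x := by
    induction x with
    | zero => simp [contractedAction_zero_left, contractedAction_zero_right, evalTensor]
    | add x x' hx hx' =>
      rw [contractedAction_add_left hA, contractedAction_add_right hA, map_add,
        LinearMap.add_apply, map_add, Submodule.coe_add,
        evalTensor_add (Subtype.prop _) (Subtype.prop _) (hf _) (hf _), hx, hx']
      abel
    | tmul p a =>
      induction y with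
      | zero => simp [contractedAction_zero_left, contractedAction_zero_right, evalTensor]
      | add y y' hy hy' =>
        rw [contractedAction_add_left hA, contractedAction_add_right hA, map_add, map_add,
          Submodule.coe_add,
          evalTensor_add (Subtype.prop _) (Subtype.prop _) (hf _) (hf _), hy, hy']
        abel
      | tmul q b =>
        rw [← sub_eq_zero, contract_compat_tmul hA hΔ, (h p q).eval_eq_zero hA.preLie]
  have had := inducedBracket_ad_columnFinite (P := P) hA.toIsGradedPreLie mul
  funext ⟨i, j⟩
  rw [Pi.sub_apply]
  refine hA.eq_of_contract hm (i := i) (j := j)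
    (map_homogeneousProj_of_mem (entry_mem (Subtype.prop _) (i, j)))
    (by rw [map_sub, map_homogeneousProj_adAction (had x) i j (Subtype.prop _),
      map_homogeneousProj_adAction (had y) i j (Subtype.prop _)]) fun c hc d hd => ?_
  rw [← evalTensor_eq_entry (Subtype.prop _) (contract_eq_zero hm hc) (contract_eq_zero hm hd),
    key, map_sub, map_contract_adAction hA hm hc hd, map_contract_adAction hA hm hc hd]

theorem IsQuadraticGradedPreLie.vanishes_compatCoeff (hA : IsQuadraticGradedPreLie 𝒜 dia ω)
    (hΔ : IsInducedCoproduct 𝒜 dia ω ΔA)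
    (h : ∀ x y, (inducedCobracket ΔP ΔA (inducedBracket mul dia x y)).1 =
      adAction (tensorGrading P 𝒜) (inducedBracket mul dia) x (inducedCobracket ΔP ΔA y).1 -
        adAction (tensorGrading P 𝒜) (inducedBracket mul dia) y
          (inducedCobracket ΔP ΔA x).1) (p q : P) :
    (compatCoeff mul ΔP p q).Vanishes 𝒜 dia ω := by
  obtain ⟨m, hm⟩ := hA.graded
  intro b i a ha j c hc l d hd
  have hc' : c ∈ 𝒜 (m - (m - j)) := by rwa [sub_sub_cancel]
  have hd' : d ∈ 𝒜 (m - (m - l)) := by rwa [sub_sub_cancel]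
  rw [← contract_compat_tmul hA hΔ, evalTensor_eq_entry (Subtype.prop _)
    (contract_eq_zero hm hc') (contract_eq_zero hm hd'), h, Pi.sub_apply, map_sub,
    map_contract_adAction hA hm hc' hd', map_contract_adAction hA hm hc' hd']
  exact sub_self _

theorem IsQuadraticGradedPreLie.isCompletedLieBialgebra
    (hA : IsQuadraticGradedPreLie 𝒜 dia ω) (hΔ : IsInducedCoproduct 𝒜 dia ω ΔA)
    (hP : IsPermBialgebra mul ΔP) :
    IsCompletedLieBialgebra (tensorGrading P 𝒜) (inducedBracket mul dia)
      (inducedCobracket ΔP ΔA) := by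
  obtain ⟨h₁, h₂, h₃⟩ := isPermBialgebra_iff.mp hP
  exact
    { lie := hA.isLieBracket h₁
      coalgebra :=
        { columnFinite := hA.inducedCobracket_columnFinite hΔ
          skew := fun _ => idSubFlip_add_completedFlip _
          coJacobi := hA.coJacobiator_eq_zero hΔ h₂ }
      ad_columnFinite := inducedBracket_ad_columnFinite hA.toIsGradedPreLie mul
      compat := hA.compat hΔ h₃ }

/-- If the ternary pre-Lie monomials of `A` satisfy no identities besides the pre-Lie ones, then a
completed Lie bialgebra on `P ⊗ A` comes from a perm bialgebra. -/
theorem IsQuadraticGradedPreLie.isPermBialgebra (hA : IsQuadraticGradedPreLie 𝒜 dia ω)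
    (hΔ : IsInducedCoproduct 𝒜 dia ω ΔA)
    (hP : ∀ v : TernaryCoeff P, v.Vanishes 𝒜 dia ω → v.IsPreLie)
    (hP₂ : ∀ v : TernaryCoeff (P ⊗[k] P), v.Vanishes 𝒜 dia ω → v.IsPreLie)
    (hP₃ : ∀ v : TernaryCoeff (P ⊗[k] (P ⊗[k] P)), v.Vanishes 𝒜 dia ω → v.IsPreLie)
    (h : IsCompletedLieBialgebra (tensorGrading P 𝒜) (inducedBracket mul dia)
      (inducedCobracket ΔP ΔA)) : IsPermBialgebra mul ΔP :=
  isPermBialgebra_iff.mpr ⟨fun p q r => hP _ (hA.vanishes_jacobiCoeff h.lie p q r),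
    fun p => hP₃ _ (hA.vanishes_coJacobiCoeff hΔ h.coalgebra.coJacobi p),
    fun p q => hP₂ _ (hA.vanishes_compatCoeff hΔ h.compat p q)⟩

end Compat

/-! ### The algebra `k[t, t⁻¹] ⊕ k[s, s⁻¹]` -/

section LaurentPair

variable {k : Type*} [Field k]

theorem laurentPair_induction {p : LaurentPair k → Prop} (t : ∀ i, p (tPow k i))
    (s : ∀ i, p (sPow k i)) (add : ∀ x y, p x → p y → p (x + y))
    (smul : ∀ (c : k) x, p x → p (c • x)) (x : LaurentPair k) : p x := by
  have hx : x ∈ Submodule.span k (Set.range (laurentBasis k)) := by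
    rw [Module.Basis.span_eq]; trivial
  induction hx using Submodule.span_induction with
  | mem x hx => obtain ⟨i | i, rfl⟩ := hx; exacts [t i, s i]
  | zero => simpa using smul 0 _ (t 0)
  | add x y _ _ hx hy => exact add x y hx hy
  | smul c x _ hx => exact smul c x hx

theorem laurentDia_t_t (i j : ℤ) :
    laurentDia k (tPow k i) (tPow k j) = (j : k) • tPow k (i + j - 1) := by
  conv_lhs => rw [tPow, tPow, laurentDia]
  simp only [Module.Basis.constr_basis]

theorem laurentDia_t_s (i j : ℤ) :
    laurentDia k (tPow k i) (sPow k j) = (2 * i + j - 1 : k) • sPow k (i + j - 1) := by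
  conv_lhs => rw [tPow, sPow, laurentDia]
  simp only [Module.Basis.constr_basis]

theorem laurentDia_s_t (i j : ℤ) :
    laurentDia k (sPow k j) (tPow k i) = (i : k) • sPow k (i + j - 1) := by
  conv_lhs => rw [tPow, sPow, laurentDia]
  simp only [Module.Basis.constr_basis]

theorem laurentDia_s_s (i j : ℤ) : laurentDia k (sPow k i) (sPow k j) = 0 := by
  conv_lhs => rw [sPow, sPow, laurentDia]
  simp only [Module.Basis.constr_basis]

theorem laurentForm_t_t (i j : ℤ) : laurentForm k (tPow k i) (tPow k j) = 0 := by
  conv_lhs => rw [tPow, tPow, laurentForm]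
  simp only [Module.Basis.constr_basis]

theorem laurentForm_t_s (i j : ℤ) :
    laurentForm k (tPow k j) (sPow k i) = if i + j = 0 then -1 else 0 := by
  conv_lhs => rw [tPow, sPow, laurentForm]
  simp only [Module.Basis.constr_basis]

theorem laurentForm_s_t (i j : ℤ) :
    laurentForm k (sPow k i) (tPow k j) = if i + j = 0 then 1 else 0 := by
  conv_lhs => rw [tPow, sPow, laurentForm]
  simp only [Module.Basis.constr_basis]

theorem laurentForm_s_s (i j : ℤ) : laurentForm k (sPow k i) (sPow k j) = 0 := by
  conv_lhs => rw [sPow, sPow, laurentForm]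
  simp only [Module.Basis.constr_basis]

theorem tPow_mem (i : ℤ) : tPow k i ∈ laurentGrading k (i - 1) :=
  Submodule.subset_span (by simp)

theorem sPow_mem (i : ℤ) : sPow k i ∈ laurentGrading k (i - 1) :=
  Submodule.subset_span (by simp)

theorem laurentForm_skew (a b : LaurentPair k) : laurentForm k a b = -laurentForm k b a := by
  induction a using laurentPair_induction with
  | add x y hx hy => rw [map_add, map_add, LinearMap.add_apply, hx, hy]; ring
  | smul c x hx => rw [map_smul, map_smul, LinearMap.smul_apply, hx, smul_neg]
  | t i =>
    induction b using laurentPair_induction with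
    | add x y hx hy => rw [map_add, map_add, LinearMap.add_apply, hx, hy]; ring
    | smul c x hx => rw [map_smul, map_smul, LinearMap.smul_apply, hx, smul_neg]
    | t j => simp [laurentForm_t_t]
    | s j => rw [laurentForm_t_s, laurentForm_s_t]; split_ifs <;> simp
  | s i =>
    induction b using laurentPair_induction with
    | add x y hx hy => rw [map_add, map_add, LinearMap.add_apply, hx, hy]; ring
    | smul c x hx => rw [map_smul, map_smul, LinearMap.smul_apply, hx, smul_neg]
    | t j => rw [laurentForm_t_s, laurentForm_s_t]; split_ifs <;> simp
    | s j => simp [laurentForm_s_s]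

/-- Pairing with `t^(-i)` and `s^(-i)` reads off, up to sign, the coordinates of `a` at `s^i` and
`t^i`. -/
theorem laurentForm_separatingLeft (a : LaurentPair k) (h : ∀ b, laurentForm k a b = 0) :
    a = 0 := by
  have ht (i : ℤ) : (laurentForm k).flip (tPow k (-i)) = (laurentBasis k).coord (Sum.inr i) := by
    refine (laurentBasis k).ext fun x => ?_
    rcases x with j | j
    · exact (laurentForm_t_t j (-i)).trans (by simp)
    · refine (laurentForm_s_t j (-i)).trans ?_
      simp [Finsupp.single_apply, add_neg_eq_zero]
  have hs (i : ℤ) : (laurentForm k).flip (sPow k (-i)) = -(laurentBasis k).coord (Sum.inl i) := by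
    refine (laurentBasis k).ext fun x => ?_
    rcases x with j | j
    · refine (laurentForm_t_s (-i) j).trans ?_
      simp only [LinearMap.neg_apply, Module.Basis.coord_apply, Module.Basis.repr_self,
        Finsupp.single_apply, Sum.inl.injEq, neg_add_eq_zero, eq_comm]
      split_ifs <;> simp
    · exact (laurentForm_s_s j (-i)).trans (by simp)
  refine (laurentBasis k).ext_elem fun x => ?_
  rcases x with i | i
  · have := (LinearMap.congr_fun (hs i) a).symm.trans (h _)
    simpa using this
  · have := (LinearMap.congr_fun (ht i) a).symm.trans (h _)
    simpa using this

theorem laurentDia_preLie (a b c : LaurentPair k) :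
    laurentDia k (laurentDia k a b) c - laurentDia k a (laurentDia k b c) =
      laurentDia k (laurentDia k b a) c - laurentDia k b (laurentDia k a c) := by
  induction a using laurentPair_induction with
  | add x y hx hy =>
    simp only [map_add, LinearMap.add_apply]; linear_combination (norm := module) hx + hy
  | smul r x hx =>
    simp only [map_smul, LinearMap.smul_apply]; linear_combination (norm := module) r • hx
  | t i | s i =>
    induction b using laurentPair_induction with
    | add x y hx hy =>
      simp only [map_add, LinearMap.add_apply]; linear_combination (norm := module) hx + hy
    | smul r x hx =>
      simp only [map_smul, LinearMap.smul_apply]; linear_combination (norm := module) r • hx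
    | t j | s j =>
      induction c using laurentPair_induction with
      | add x y hx hy =>
        simp only [map_add]; linear_combination (norm := module) hx + hy
      | smul r x hx =>
        simp only [map_smul]; linear_combination (norm := module) r • hx
      | t l | s l =>
        -- All ternary monomials land in the same exponent `i + j + l - 2`, leaving polynomial
        -- identities in the coefficients.
        have e₁ : i + (j + l - 1) - 1 = i + j + l - 2 := by ring
        have e₂ : i + j - 1 + l - 1 = i + j + l - 2 := by ring
        have e₃ : j + i - 1 + l - 1 = i + j + l - 2 := by ring
        have e₄ : j + (i + l - 1) - 1 = i + j + l - 2 := by ring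
        have e₅ : l + (j + i - 1) - 1 = i + j + l - 2 := by ring
        have e₆ : l + (i + j - 1) - 1 = i + j + l - 2 := by ring
        have e₇ : i + (l + j - 1) - 1 = i + j + l - 2 := by ring
        have e₈ : j + (l + i - 1) - 1 = i + j + l - 2 := by ring
        have e₉ : j + l - 1 + i - 1 = i + j + l - 2 := by ring
        have e₁₀ : i + l - 1 + j - 1 = i + j + l - 2 := by ring
        simp only [laurentDia_t_t, laurentDia_t_s, laurentDia_s_t, laurentDia_s_s, map_smul,
          LinearMap.smul_apply, map_zero, LinearMap.zero_apply, e₁, e₂, e₃, e₄, e₅, e₆, e₇, e₈, e₉,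
          e₁₀] <;> push_cast <;> module

theorem laurentForm_invariant (a b c : LaurentPair k) :
    laurentForm k (laurentDia k a b) c =
      -laurentForm k b (laurentDia k a c - laurentDia k c a) := by
  induction a using laurentPair_induction with
  | add x y hx hy =>
    simp only [map_add, map_sub, LinearMap.add_apply] at *; linear_combination hx + hy
  | smul r x hx =>
    simp only [map_smul, map_sub, LinearMap.smul_apply, smul_eq_mul] at *
    linear_combination r * hx
  | t i | s i =>
    induction b using laurentPair_induction with
    | add x y hx hy =>
      simp only [map_add, map_sub, LinearMap.add_apply] at *; linear_combination hx + hy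
    | smul r x hx =>
      simp only [map_smul, map_sub, LinearMap.smul_apply, smul_eq_mul] at *
      linear_combination r * hx
    | t j | s j =>
      induction c using laurentPair_induction with
      | add x y hx hy =>
        simp only [map_add, map_sub, LinearMap.add_apply] at *; linear_combination hx + hy
      | smul r x hx =>
        simp only [map_smul, map_sub, LinearMap.smul_apply, smul_eq_mul] at *
        linear_combination r * hx
      | t l | s l =>
        -- Every Kronecker delta that occurs is the condition `i + j + l = 1`; the coefficients need
        -- to agree only there.
        have e₁ : l + (i + j - 1) = 0 ↔ i + j + l = 1 := by omega
        have e₂ : i + l - 1 + j = 0 ↔ i + j + l = 1 := by omega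
        have e₃ : l + i - 1 + j = 0 ↔ i + j + l = 1 := by omega
        have e₄ : j + (i + l - 1) = 0 ↔ i + j + l = 1 := by omega
        have e₅ : j + (l + i - 1) = 0 ↔ i + j + l = 1 := by omega
        have e₆ : i + j - 1 + l = 0 ↔ i + j + l = 1 := by omega
        have e₇ : j + i - 1 + l = 0 ↔ i + j + l = 1 := by omega
        simp only [laurentDia_t_t, laurentDia_t_s, laurentDia_s_t, laurentDia_s_s, map_smul,
          LinearMap.smul_apply, map_zero, LinearMap.zero_apply, map_sub, laurentForm_t_t,
          laurentForm_t_s, laurentForm_s_t, laurentForm_s_s, e₁, e₂, e₃, e₄, e₅, e₆, e₇,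
          smul_eq_mul]
        try split_ifs with h
        all_goals first
        | ring1
        | obtain rfl : l = 1 - i - j := by omega
          push_cast
          ring1

theorem laurentDia_mem (i j : ℤ) (a b : LaurentPair k) (ha : a ∈ laurentGrading k i)
    (hb : b ∈ laurentGrading k j) : laurentDia k a b ∈ laurentGrading k (i + j) := by
  obtain ⟨x, y, rfl⟩ := Submodule.mem_span_pair.mp ha
  obtain ⟨z, w, rfl⟩ := Submodule.mem_span_pair.mp hb
  have ht : tPow k (i + j + 1) ∈ laurentGrading k (i + j) := Submodule.subset_span (by simp)
  have hs : sPow k (i + j + 1) ∈ laurentGrading k (i + j) := Submodule.subset_span (by simp)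
  have e₁ : i + 1 + (j + 1) - 1 = i + j + 1 := by ring
  have e₂ : j + 1 + (i + 1) - 1 = i + j + 1 := by ring
  simp only [map_add, map_smul, LinearMap.add_apply, LinearMap.smul_apply, laurentDia_t_t,
    laurentDia_t_s, laurentDia_s_t, laurentDia_s_s, e₁, e₂]
  exact add_mem
    (Submodule.smul_mem _ _ (add_mem (Submodule.smul_mem _ _ (Submodule.smul_mem _ _ ht))
      (Submodule.smul_mem _ _ (Submodule.smul_mem _ _ hs))))
    (Submodule.smul_mem _ _ (add_mem (Submodule.smul_mem _ _ (Submodule.smul_mem _ _ hs))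
      (Submodule.smul_mem _ _ (zero_mem _))))

theorem laurentForm_eq_zero (i j : ℤ) (hij : i + j ≠ -2) (a : LaurentPair k)
    (ha : a ∈ laurentGrading k i) (b : LaurentPair k) (hb : b ∈ laurentGrading k j) :
    laurentForm k a b = 0 := by
  obtain ⟨x, y, rfl⟩ := Submodule.mem_span_pair.mp ha
  obtain ⟨z, w, rfl⟩ := Submodule.mem_span_pair.mp hb
  have e₁ : ¬i + 1 + (j + 1) = 0 := by omega
  have e₂ : ¬j + 1 + (i + 1) = 0 := by omega
  simp only [map_add, map_smul, LinearMap.add_apply, LinearMap.smul_apply, laurentForm_t_t,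
    laurentForm_t_s, laurentForm_s_t, laurentForm_s_s, e₁, e₂, if_false, smul_zero, add_zero]

theorem laurentGrading_finiteDimensional (i : ℤ) : FiniteDimensional k (laurentGrading k i) :=
  FiniteDimensional.span_of_finite k (Set.toFinite _)

theorem laurentPair_isQuadraticGradedPreLie :
    IsQuadraticGradedPreLie (laurentGrading k) (laurentDia k) (laurentForm k) where
  preLie := laurentDia_preLie
  finiteDimensional := laurentGrading_finiteDimensional
  mem := laurentDia_mem
  skew := laurentForm_skew
  nondegenerate := ⟨laurentForm_separatingLeft, fun a h =>
    laurentForm_separatingLeft a fun b => by rw [laurentForm_skew, h, neg_zero]⟩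
  invariant := laurentForm_invariant
  -- Exponent `i` has degree `i - 1`, and paired exponents sum to zero, hence degrees sum to `-2`.
  graded := ⟨-2, laurentForm_eq_zero⟩

/-- The ternary monomials of `k[t, t⁻¹] ⊕ k[s, s⁻¹]` satisfy no identities besides the pre-Lie
ones. -/
theorem TernaryCoeff.Vanishes.isPreLie [CharZero k] {V : Type*} [AddCommGroup V] [Module k V]
    {v : TernaryCoeff V} (h : v.Vanishes (laurentGrading k) (laurentDia k) (laurentForm k)) :
    v.IsPreLie := by
  -- Exponents with sum 2 make every ternary monomial a multiple of `t^0` or `s^0`, which pairs with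
  -- `s^0` or `t^0`. The `t`-part has product `f ⋄ g = f g'`, which is Novikov and satisfies the
  -- extra identity `(a ⋄ b) ⋄ c = (a ⋄ c) ⋄ b`; so the six `t`-only evaluations cannot suffice, and
  -- three with an argument `s^0` are added.
  have hs (i j l n : ℤ) :=
    h (sPow k n) _ _ (tPow_mem i) _ _ (tPow_mem j) _ _ (tPow_mem l)
  have r0 := hs 0 0 2 0
  have r1 := hs 0 2 0 0
  have r2 := hs 2 0 0 0
  have r3 := hs 0 1 1 0
  have r4 := hs 1 0 1 0
  have r5 := hs 1 1 0 0
  have r6 := h (tPow k 0) _ _ (tPow_mem 0) _ _ (tPow_mem 2) _ _ (sPow_mem 0)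
  have r7 := h (tPow k 0) _ _ (tPow_mem 2) _ _ (tPow_mem 0) _ _ (sPow_mem 0)
  have r8 := h (tPow k 0) _ _ (tPow_mem 2) _ _ (sPow_mem 0) _ _ (tPow_mem 0)
  simp [TernaryCoeff.eval, laurentDia_t_t, laurentDia_t_s, laurentDia_s_t, laurentForm_t_s,
    laurentForm_s_t] at r0 r1 r2 r3 r4 r5 r6 r7 r8
  -- Each of the nine equations is solved from the nine evaluations; the denominators 4 are where
  -- characteristic zero enters.
  constructor
  · linear_combination (norm := module) (1/4 : k) • r0 + (-1/4 : k) • r1 + (1/2 : k) • r3 +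
      (-1/4 : k) • r6
  · linear_combination (norm := module) (-1/4 : k) • r1 + (-1/4 : k) • r2 + (1/2 : k) • r3 +
      (1/2 : k) • r4 + (-1/4 : k) • r6 + (-1/4 : k) • r7
  · linear_combination (norm := module) (-1/4 : k) • r0 + (-1/4 : k) • r1 + (1/2 : k) • r3 +
      (-1/4 : k) • r6
  · linear_combination (norm := module) (-1/4 : k) • r0 + (1/4 : k) • r2 + (1/2 : k) • r4 +
      (1/4 : k) • r7
  · linear_combination (norm := module) (-1/4 : k) • r0 + (-1/4 : k) • r1 + (1/2 : k) • r4 +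
      (1/2 : k) • r5 + (1/4 : k) • r7 + (1/4 : k) • r8
  · linear_combination (norm := module) (-1/4 : k) • r0 + (-1/4 : k) • r2 + (1/2 : k) • r4 +
      (1/4 : k) • r7
  · linear_combination (norm := module) (-1/4 : k) • r0 + (1/4 : k) • r1 + (1/2 : k) • r3 +
      (1/4 : k) • r6
  · linear_combination (norm := module) (-1/4 : k) • r0 + (-1/4 : k) • r2 + (1/2 : k) • r3 +
      (1/2 : k) • r5 + (1/4 : k) • r6 + (-1/4 : k) • r8
  · linear_combination (norm := module) (-1/4 : k) • r0 + (-1/4 : k) • r1 + (1/2 : k) • r3 +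
      (1/4 : k) • r6

end LaurentPair

/-! ### Finite-dimensionality of the components of `P ⊗ A` -/

section FiniteDimensional

variable {k : Type*} [Field k] {P : Type*} [AddCommGroup P] [Module k P]

theorem finiteDimensional_tensorGrading {A : Type*} [AddCommGroup A] [Module k A]
    {𝒜 : ℤ → Submodule k A} (h𝒜 : ∀ i, FiniteDimensional k (𝒜 i)) [FiniteDimensional k P]
    (i : ℤ) : FiniteDimensional k (tensorGrading P 𝒜 i) :=
  have := h𝒜 i
  LinearMap.finiteDimensional_range _

/-- `P` embeds in the degree 0 component by `p ↦ p ⊗ t`; contracting with `s^(-1)` returns `-p`,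
which gives injectivity. -/
theorem finiteDimensional_of_tensorGrading_laurent
    (h : FiniteDimensional k (tensorGrading P (laurentGrading k) 0)) : FiniteDimensional k P := by
  let f : P →ₗ[k] tensorGrading P (laurentGrading k) 0 :=
    LinearMap.codRestrict _ ((TensorProduct.mk k P (LaurentPair k)).flip (tPow k 1))
      fun p => tmul_mem_tensorGrading p (tPow_mem 1)
  refine FiniteDimensional.of_injective f ((injective_iff_map_eq_zero f).mpr fun p hp => ?_)
  have : contract (laurentForm k) P (sPow k (-1)) (p ⊗ₜ tPow k 1) = _ :=
    congrArg (contract (laurentForm k) P (sPow k (-1))) (congrArg Subtype.val hp)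
  simpa [laurentForm_t_s] using this

end FiniteDimensional

end PermAffinization

end

open PermAffinization in
theorem mainTheorem1 {k : Type*} [Field k] [CharZero k]
    {P : Type*} [AddCommGroup P] [Module k P]
    (mul : P →ₗ[k] P →ₗ[k] P) (ΔP : P →ₗ[k] P ⊗[k] P)
    {A : Type*} [AddCommGroup A] [Module k A]
    (𝒜 : ℤ → Submodule k A) [DirectSum.Decomposition 𝒜]
    (dia : A →ₗ[k] A →ₗ[k] A) (ω : LinearMap.BilinForm k A) :
    -- Perm bialgebras and quadratic graded pre-Lie algebras give completed Lie bialgebras.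
    (IsPermBialgebra mul ΔP → IsQuadraticGradedPreLie 𝒜 dia ω →
      (∃! ΔA : A →ₗ[k] completedTensor 𝒜 𝒜, IsInducedCoproduct 𝒜 dia ω ΔA) ∧
      (∀ ΔA : A →ₗ[k] completedTensor 𝒜 𝒜, IsInducedCoproduct 𝒜 dia ω ΔA →
        IsCompletedLieBialgebra (tensorGrading P 𝒜)
          (inducedBracket mul dia) (inducedCobracket ΔP ΔA)) ∧
      (FiniteDimensional k P → ∀ i : ℤ, FiniteDimensional k (tensorGrading P 𝒜 i))) ∧
    -- For `k[t, t⁻¹] ⊕ k[s, s⁻¹]` the converse holds, for arbitrary linear data on `P`.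
    (IsQuadraticGradedPreLie (laurentGrading k) (laurentDia k) (laurentForm k) ∧
      (∃! ΔA : LaurentPair k →ₗ[k] completedTensor (laurentGrading k) (laurentGrading k),
        IsInducedCoproduct (laurentGrading k) (laurentDia k) (laurentForm k) ΔA) ∧
      (∀ ΔA : LaurentPair k →ₗ[k] completedTensor (laurentGrading k) (laurentGrading k),
        IsInducedCoproduct (laurentGrading k) (laurentDia k) (laurentForm k) ΔA →
        (IsCompletedLieBialgebra (tensorGrading P (laurentGrading k))
            (inducedBracket mul (laurentDia k)) (inducedCobracket ΔP ΔA) ↔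
          IsPermBialgebra mul ΔP)) ∧
      ((∀ i : ℤ, FiniteDimensional k (tensorGrading P (laurentGrading k) i)) ↔
        FiniteDimensional k P)) := by
  have hL := laurentPair_isQuadraticGradedPreLie (k := k)
  refine ⟨fun hP hA => ⟨?_, fun ΔA hΔ => hA.isCompletedLieBialgebra hΔ hP,
    fun _ => finiteDimensional_tensorGrading hA.finiteDimensional⟩, hL, ?_, fun ΔA hΔ =>
    ⟨fun h => hL.isPermBialgebra hΔ (fun _ => TernaryCoeff.Vanishes.isPreLie)
      (fun _ => TernaryCoeff.Vanishes.isPreLie) (fun _ => TernaryCoeff.Vanishes.isPreLie) h,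
      hL.isCompletedLieBialgebra hΔ⟩,
    fun h => finiteDimensional_of_tensorGrading_laurent (h 0),
    fun _ => finiteDimensional_tensorGrading laurentGrading_finiteDimensional⟩
  · obtain ⟨Δ, hΔ⟩ := hA.exists_inducedCoproduct
    exact ⟨Δ, hΔ, fun Δ' hΔ' => hA.inducedCoproduct_unique hΔ' hΔ⟩
  · obtain ⟨Δ, hΔ⟩ := hL.exists_inducedCoproduct
    exact ⟨Δ, hΔ, fun Δ' hΔ' => hL.inducedCoproduct_unique hΔ' hΔ⟩
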